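/- Let $d\ge 1$ and let $\Omega\subset\mathbb{R}^d$ be a domain (nonempty, open, bounded, connected) with $C^1$ boundary, i.e. near every $x\in\partial\Omega$, in suitable Euclidean coordinates, $\Omega$ is the set of points lying strictly above the graph of a $C^1$ function and $\partial\Omega$ is that graph; let $\nu$ be the outward unit normal. For $x,y\in\overline\Omega$ let $d_\Omega(x,y)$ be the infimum of the lengths of paths in $\overline\Omega$ from $x$ to $y$, and for $\epsilon>0$ put $B(x,\epsilon)=\{y\in\overline\Omega: d_\Omega(x,y)\le\epsilon\}$ and $$\Delta_\infty^{\epsilon}u(x)=\frac{\min_{B(x,\epsilon)}u+\max_{B(x,\epsilon)}u-2u(x)}{\epsilon^2}.$$ Let $f\colon\overline\Omega\to\mathbb{R}$ be continuous. For a bounded $g\colon\overline\Omega\to\mathbb{R}$ let $w_n(x)$ be the value of the following $n$-step zero-sum game (supremum over strategies of Player I of the infimum over strategies of Player II of the expected payoff to Player I) with initial position $x$. At each step, when the token is at $y$, Player II pays Player I the amount $f(y)$, a fair coin is tossed, and the winner moves the token to a point of $B(y,\epsilon)$ of his choice, which may depend on the past positions and tosses; after $n$ steps Player II pays Player I the value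 of $g$ at the final position. Let $c_f(\epsilon)$ denote the constant $c$ such that, for every bounded $g$, $w_n-nc$ is bounded uniformly in $n$ and on $\overline\Omega$. For a $C^2$ function $\varphi$ let $\Delta_\infty^+\varphi(x)=|\nabla\varphi(x)|^{-2}\sum_{i,j}\varphi_{x_i}\varphi_{x_ix_j}\varphi_{x_j}(x)$ if $\nabla\varphi(x)\neq0$, and $\Delta_\infty^+\varphi(x)=\max_{|v|=1}\sum_{i,j}\varphi_{x_ix_j}(x)v_iv_j$ if $\nabla\varphi(x)=0$. A continuous $u\colon\overline\Omega\to\mathbb{R}$ is a viscosity subsolution of $$-\Delta_\infty u=h\ \text{ in }\Omega,\qquad \nabla_\nu u=0\ \text{ on }\partial\Omega\qquad(*)$$ if, for every $\varphi$ that is $C^\infty$ on an open set containing $\overline\Omega$ and every $x_0\in\overline\Omega$ at which $u-\varphi$ has a strict local maximum relative to $\overline\Omega$, either $-\Delta_\infty^+\varphi(x_0)\le h(x_0)$, or $x_0\in\partial\Omega$ and $\nabla_{\nu(x_0)}\varphi(x_0)\le0$. It is a viscosity supersolution if $-u$ is a viscosity subsolution of $(*)$ with $-h$ in place of $h$, and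 a viscosity solution if it is both. **Theorem.** Let $(\epsilon_n)$ be a sequence of positive reals converging to $0$, let $(u_n)$ be continuous functions on $\overline\Omega$ with $-\Delta_\infty^{\epsilon_n}u_n=f-c_f(\epsilon_n)$ on $\overline\Omega$ for all $n$, and let $u$ be the uniform limit of a subsequence of $(u_n)$. Then the constants $c_f(\epsilon)$ are well defined for all $\epsilon>0$, the limit $\overline c_f=\lim_{\epsilon\downarrow0}c_f(\epsilon)$ exists, and $u$ is a viscosity solution of $$-\Delta_\infty u=f-\overline c_f\ \text{ in }\Omega,\qquad \nabla_\nu u=0\ \text{ on }\partial\Omega.$$ -/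

import Mathlib

open Set Filter Topology
open scoped ENNReal ContDiff

noncomputable section

namespace TugOfWar

/-! ## The finite-horizon tug-of-war game on a graph -/

section Game

variable {V : Type*}

/-- A strategy on the graph with adjacency relation `adj`: given the current position of the token
and the list of past (coin toss, position) pairs, most recent first, it returns a neighbour of the
current position. -/
structure Strategy (adj : V → V → Prop) where
  move : V → List (Bool × V) → V
  move_adj : ∀ x h, adj x (move x h)

/-- Expected payoff over the next `n` steps, when the token is at `x`, the past is `h`, and the
players use the strategies `S₁` and `S₂`. At each step Player II pays `f` at the current position to
Player I, and the winner of a fair coin toss (`true`: Player I) moves the token. When no step is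
left, Player II pays `g` at the final position. -/
def expectedPayoff {adj : V → V → Prop} (f g : V → ℝ) (S₁ S₂ : Strategy adj) :
    ℕ → V → List (Bool × V) → ℝ
  | 0, x, _ => g x
  | n + 1, x, h =>
      f x + (1 / 2) * (expectedPayoff f g S₁ S₂ n (S₁.move x h) ((true, x) :: h)
        + expectedPayoff f g S₁ S₂ n (S₂.move x h) ((false, x) :: h))

/-- The value (for Player I) of the game of horizon `n` started at `x`, with running payoff `f` and
terminal payoff `g`. -/
def gameValue (adj : V → V → Prop) (f g : V → ℝ) (n : ℕ) (x : V) : ℝ :=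
  ⨆ S₁ : Strategy adj, ⨅ S₂ : Strategy adj, expectedPayoff f g S₁ S₂ n x []

/-- `c` is Player I's long term advantage for `f`: for every bounded terminal payoff `g` the game
values `u_n` are such that `u_n - n c` is bounded, uniformly in `n`. -/
def IsLongTermAdvantage (adj : V → V → Prop) (f : V → ℝ) (c : ℝ) : Prop :=
  ∀ g : V → ℝ, (∃ K, ∀ x, |g x| ≤ K) →
    ∃ C, ∀ (n : ℕ) (x : V), |gameValue adj f g n x - n * c| ≤ C

/-- Player I's long term advantage for `f` (a constant as above, if there is one). -/
def longTermAdvantage (adj : V → V → Prop) (f : V → ℝ) : ℝ :=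
  Classical.epsilon (IsLongTermAdvantage adj f)

end Game

/-! ## The intrinsic metric and the step-`ε` game on a set -/

section Intrinsic

variable {d : ℕ}

/-- The intrinsic distance in `S`: the infimum of the lengths of the paths in `S` from `x` to `y`
(`∞` if there is no rectifiable path). -/
def intrinsicEDist {S : Set (EuclideanSpace ℝ (Fin d))} (x y : S) : ℝ≥0∞ :=
  ⨅ γ : Path x y, eVariationOn (fun t : unitInterval => (γ t : EuclideanSpace ℝ (Fin d))) univ

/-- The closed ball `B(x, ε)` of the intrinsic metric. -/
def intrinsicBall {S : Set (EuclideanSpace ℝ (Fin d))} (x : S) (ε : ℝ) : Set S :=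
  {y | intrinsicEDist x y ≤ ENNReal.ofReal ε}

/-- The edges of the `ε`-adjacency graph on `S`. -/
def epsAdj (S : Set (EuclideanSpace ℝ (Fin d))) (ε : ℝ) (x y : S) : Prop :=
  intrinsicEDist x y ≤ ENNReal.ofReal ε

/-- The `ε`-discrete infinity Laplacian
`(min_{B(x,ε)} u + max_{B(x,ε)} u - 2 u(x)) / ε²`. -/
def discreteInfLaplacian {S : Set (EuclideanSpace ℝ (Fin d))} (ε : ℝ) (u : S → ℝ) (x : S) : ℝ :=
  (sInf (u '' intrinsicBall x ε) + sSup (u '' intrinsicBall x ε) - 2 * u x) / ε ^ 2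

/-- The constant `c_f(ε)`: the long term advantage for `f` on the `ε`-adjacency graph on `S`. -/
def shiftConst {S : Set (EuclideanSpace ℝ (Fin d))} (f : S → ℝ) (ε : ℝ) : ℝ :=
  longTermAdvantage (epsAdj S ε) f

/-- The constant `lim_{ε ↓ 0} c_f(ε)`. -/
def limitShiftConst {S : Set (EuclideanSpace ℝ (Fin d))} (f : S → ℝ) : ℝ :=
  limUnder (𝓝[>] (0 : ℝ)) (shiftConst f)

end Intrinsic

/-! ## Domains with `C¹` boundary -/

section Boundary

variable {d : ℕ}

/-- A local description of `Ω` near its boundary point `x`, in some Euclidean coordinates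
`(y, t) ∈ ℝ^(d-1) × ℝ`, as the set above the graph of a `C¹` function. -/
structure C1Chart (Ω : Set (EuclideanSpace ℝ (Fin d))) (x : EuclideanSpace ℝ (Fin d)) where
  U : Set (EuclideanSpace ℝ (Fin (d - 1)))
  V : Set (EuclideanSpace ℝ (Fin d))
  φ : EuclideanSpace ℝ (Fin (d - 1)) → ℝ
  T : WithLp 2 (EuclideanSpace ℝ (Fin (d - 1)) × ℝ) ≃ᵃⁱ[ℝ] EuclideanSpace ℝ (Fin d)
  isOpen_U : IsOpen U
  zero_mem_U : 0 ∈ U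
  isOpen_V : IsOpen V
  mem_V : x ∈ V
  contDiffOn_φ : ContDiffOn ℝ 1 φ U
  map_base : T (WithLp.toLp 2 (0, φ 0)) = x
  graph_eq : (fun y => T (WithLp.toLp 2 (y, φ y))) '' U = V ∩ frontier Ω
  above_eq : V ∩ {p | ∃ y ∈ U, ∃ t, φ y < t ∧ p = T (WithLp.toLp 2 (y, t))} = V ∩ Ω

/-- The outward unit normal read off from a chart: the normalization of `(∇φ(0), -1)`. -/
def C1Chart.normal {Ω : Set (EuclideanSpace ℝ (Fin d))} {x : EuclideanSpace ℝ (Fin d)}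
    (c : C1Chart Ω x) : EuclideanSpace ℝ (Fin d) :=
  (Real.sqrt (1 + ‖gradient c.φ 0‖ ^ 2))⁻¹ •
    c.T.linearIsometryEquiv (WithLp.toLp 2 (gradient c.φ 0, (-1 : ℝ)))

/-- `Ω` has `C¹` boundary. -/
def HasC1Boundary (Ω : Set (EuclideanSpace ℝ (Fin d))) : Prop :=
  ∀ x ∈ frontier Ω, Nonempty (C1Chart Ω x)

open Classical in
/-- The outward unit normal `ν(x)` to `∂Ω` at `x`. It does not depend on the chart; the value is `0`
at points where there is no chart. -/
def outwardNormal (Ω : Set (EuclideanSpace ℝ (Fin d))) (x : EuclideanSpace ℝ (Fin d)) :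
    EuclideanSpace ℝ (Fin d) :=
  if h : Nonempty (C1Chart Ω x) then h.some.normal else 0

end Boundary

/-! ## Viscosity solutions of the infinity Laplace equation with Neumann condition -/

section Viscosity

variable {d : ℕ}

/-- The Hessian quadratic form `∑ᵢⱼ φ_{xᵢxⱼ}(x) vᵢ vⱼ`. -/
def hessianForm (φ : EuclideanSpace ℝ (Fin d) → ℝ) (x v : EuclideanSpace ℝ (Fin d)) : ℝ :=
  fderiv ℝ (fderiv ℝ φ) x v v

open Classical in
/-- The operator `Δ_∞⁺`: the second derivative in the direction of the gradient, and at critical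
points the maximum of the Hessian form over unit vectors. -/
def infLaplacianPlus (φ : EuclideanSpace ℝ (Fin d) → ℝ) (x : EuclideanSpace ℝ (Fin d)) : ℝ :=
  if gradient φ x = 0 then sSup (hessianForm φ x '' {v | ‖v‖ = 1})
  else (‖gradient φ x‖ ^ 2)⁻¹ * hessianForm φ x (gradient φ x)

/-- `u` is a viscosity subsolution of `-Δ_∞ u = f` in `Ω`, `∇_ν u = 0` on `∂Ω`. -/
def IsViscositySubsolution (Ω : Set (EuclideanSpace ℝ (Fin d))) (f u : closure Ω → ℝ) : Prop :=
  Continuous u ∧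
    ∀ φ : EuclideanSpace ℝ (Fin d) → ℝ,
      (∃ W, IsOpen W ∧ closure Ω ⊆ W ∧ ContDiffOn ℝ ∞ φ W) →
      ∀ x₀ : closure Ω, (∀ᶠ x in 𝓝[≠] x₀, u x - φ x < u x₀ - φ x₀) →
        -infLaplacianPlus φ x₀ ≤ f x₀ ∨
          ((x₀ : EuclideanSpace ℝ (Fin d)) ∈ frontier Ω ∧
            inner ℝ (gradient φ x₀) (outwardNormal Ω x₀) ≤ 0)

/-- `u` is a viscosity supersolution: `-u` is a subsolution for `-f`. -/
def IsViscositySupersolution (Ω : Set (EuclideanSpace ℝ (Fin d))) (f u : closure Ω → ℝ) : Prop :=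
  IsViscositySubsolution Ω (fun x => -f x) (fun x => -u x)

/-- `u` is a viscosity solution of `-Δ_∞ u = f` in `Ω`, `∇_ν u = 0` on `∂Ω`. -/
def IsViscositySolution (Ω : Set (EuclideanSpace ℝ (Fin d))) (f u : closure Ω → ℝ) : Prop :=
  IsViscositySubsolution Ω f u ∧ IsViscositySupersolution Ω f u

end Viscosity

end TugOfWar

end

/-!
The proof has three parts.

*The constants.* By the dynamic programming principle (`gameValue_eq_iterate_stepOp`) the value of
the `n`-step game is the `n`-th iterate of `v ↦ f + (sup v + inf v) / 2`, with the supremum and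
the infimum over the balls of radius `ε`. The intrinsic metric makes `closure Ω` a bounded
geodesic space (`exists_isBoundedGeodesic_intrinsicEDist`). On such a space a subsolution
(`IsBoundedSubsolution`) satisfies a discrete Lipschitz estimate
(`IsBoundedGeodesic.sub_le_of_isBoundedSubsolution`): along a path of steepest ascent its
increments decrease slowly, so a large increment would be repeated more often than the oscillation
permits. Hence the `n`-step values have an oscillation bounded in `n`, and the long term advantage
exists; it is the supremum of the constants `a` that admit a subsolution.

*The limit of the constants.* Maxima over balls of radius `t` of a subsolution for the step size
`ε` are semiconvex in `t` along steps of length `ε`. Summation turns a subsolution for `ε` into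
one for a larger step size `δ`, with almost the same constant: the loss consists of the
oscillation of `f` over balls of radius `2 * δ` and of a term of order `ε / δ ^ 2`, which comes
from the Lipschitz estimate because `δ` need not be a multiple of `ε`
(`IsBoundedGeodesic.exists_isBoundedSubsolution_of_le`). With the same statement for `-f`, this
shows that `c_f(ε)` is Cauchy as `ε` decreases to `0`.

*The equation.* Let `φ` touch the limit from above at `x₀`. At nearby maximum points of `u_n - φ`
the discrete infinity Laplacian of `u_n` is at most that of `φ`. If the gradient of `φ` does not
vanish, the maximum of `φ` over a ball is estimated by the Euclidean ball and the minimum by the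
step against the gradient; at a boundary point where the Neumann condition fails, the gradient
points outward, so that this step stays in `closure Ω` (`C1Chart.isInwardAt`). At an interior
critical point this comparison loses a factor when the Hessian is negative, and `φ` is replaced by
a parabola with a vertex `x₁` close to, but different from, `x₀`. The maximum is then not attained
at the vertex, and away from the vertex the discrete infinity Laplacian of the parabola has the
right value (`hasDiscreteBound_quadratic`).
-/

/-! ### Suprema of bounded functions over neighbourhoods -/

namespace TugOfWar

section Bounded

variable {V : Type*} {v w : V → ℝ} {A : Set V}

theorem bddAbove_image_of_bounded (hv : ∃ K, ∀ x, |v x| ≤ K) (A : Set V) : BddAbove (v '' A) := by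
  obtain ⟨K, hK⟩ := hv
  exact ⟨K, by rintro _ ⟨y, -, rfl⟩; exact (abs_le.1 (hK y)).2⟩

theorem bddBelow_image_of_bounded (hv : ∃ K, ∀ x, |v x| ≤ K) (A : Set V) : BddBelow (v '' A) := by
  obtain ⟨K, hK⟩ := hv
  exact ⟨-K, by rintro _ ⟨y, -, rfl⟩; exact (abs_le.1 (hK y)).1⟩

theorem le_sSup_image (hv : ∃ K, ∀ x, |v x| ≤ K) {y : V} (hy : y ∈ A) : v y ≤ sSup (v '' A) :=
  le_csSup (bddAbove_image_of_bounded hv A) (mem_image_of_mem v hy)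

theorem sInf_image_le (hv : ∃ K, ∀ x, |v x| ≤ K) {y : V} (hy : y ∈ A) : sInf (v '' A) ≤ v y :=
  csInf_le (bddBelow_image_of_bounded hv A) (mem_image_of_mem v hy)

theorem sSup_image_le (hA : A.Nonempty) {c : ℝ} (h : ∀ y ∈ A, v y ≤ c) : sSup (v '' A) ≤ c :=
  csSup_le (hA.image v) (by rintro _ ⟨y, hy, rfl⟩; exact h y hy)

theorem le_sInf_image (hA : A.Nonempty) {c : ℝ} (h : ∀ y ∈ A, c ≤ v y) : c ≤ sInf (v '' A) :=
  le_csInf (hA.image v) (by rintro _ ⟨y, hy, rfl⟩; exact h y hy)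

theorem exists_lt_of_lt_sSup_image (hA : A.Nonempty) {c : ℝ} (h : c < sSup (v '' A)) :
    ∃ y ∈ A, c < v y := by
  obtain ⟨_, ⟨y, hy, rfl⟩, h⟩ := exists_lt_of_lt_csSup (hA.image v) h
  exact ⟨y, hy, h⟩

theorem exists_lt_of_sInf_image_lt (hA : A.Nonempty) {c : ℝ} (h : sInf (v '' A) < c) :
    ∃ y ∈ A, v y < c := by
  obtain ⟨_, ⟨y, hy, rfl⟩, h⟩ := exists_lt_of_csInf_lt (hA.image v) h
  exact ⟨y, hy, h⟩

theorem image_neg_eq (v : V → ℝ) (A : Set V) : (fun x => -v x) '' A = -(v '' A) := by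
  rw [← Set.image_neg_eq_neg, Set.image_image]

theorem sSup_image_neg (v : V → ℝ) (A : Set V) :
    sSup ((fun x => -v x) '' A) = -sInf (v '' A) := by
  rw [image_neg_eq, Real.sInf_def, neg_neg]

theorem sInf_image_neg (v : V → ℝ) (A : Set V) :
    sInf ((fun x => -v x) '' A) = -sSup (v '' A) := by
  rw [image_neg_eq, Real.sInf_def, neg_neg]

theorem bounded_neg (hv : ∃ K, ∀ x, |v x| ≤ K) : ∃ K, ∀ x, |-v x| ≤ K := by
  simpa only [abs_neg] using hv

end Bounded

/-! ### The dynamic programming principle -/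

section Game

variable {V : Type*} {adj : V → V → Prop} {f g : V → ℝ}

/-- The operator of the dynamic programming principle: it sends the value of the game with `n`
steps left to the value with `n + 1` steps left. -/
noncomputable def stepOp (adj : V → V → Prop) (f v : V → ℝ) (x : V) : ℝ :=
  f x + (1 / 2) * (sSup (v '' {y | adj x y}) + sInf (v '' {y | adj x y}))

theorem bounded_stepOp (hrefl : ∀ x, adj x x) (hf : ∃ K, ∀ x, |f x| ≤ K) {v : V → ℝ}
    (hv : ∃ K, ∀ x, |v x| ≤ K) : ∃ K, ∀ x, |stepOp adj f v x| ≤ K := by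
  obtain ⟨F, hF⟩ := hf
  obtain ⟨K, hK⟩ := id hv
  refine ⟨F + K, fun x => ?_⟩
  have hne : {y | adj x y}.Nonempty := ⟨x, hrefl x⟩
  have h1 := sSup_image_le (v := v) hne (c := K) fun y _ => (abs_le.1 (hK y)).2
  have h2 := le_sInf_image (v := v) hne (c := -K) fun y _ => (abs_le.1 (hK y)).1
  have h3 := le_sSup_image hv (show x ∈ {y | adj x y} from hrefl x)
  have h4 := sInf_image_le hv (show x ∈ {y | adj x y} from hrefl x)
  have h5 := abs_le.1 (hF x)
  have h6 := abs_le.1 (hK x)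
  unfold stepOp
  rw [abs_le]
  constructor <;> linarith

theorem bounded_iterate_stepOp (hrefl : ∀ x, adj x x) (hf : ∃ K, ∀ x, |f x| ≤ K)
    (hg : ∃ K, ∀ x, |g x| ≤ K) (n : ℕ) : ∃ K, ∀ x, |(stepOp adj f)^[n] g x| ≤ K := by
  induction n with
  | zero => exact hg
  | succ n ih =>
    rw [Function.iterate_succ']
    exact bounded_stepOp hrefl hf ih

/-- If Player I always moves to a point which maximizes up to `η` the value of the game with the
remaining number of steps, the expected payoff falls short of the value by at most `η` per step. -/
theorem iterate_stepOp_sub_le_expectedPayoff (hrefl : ∀ x, adj x x) (hf : ∃ K, ∀ x, |f x| ≤ K)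
    (hg : ∃ K, ∀ x, |g x| ≤ K) {η : ℝ} (hη : 0 ≤ η) {N : ℕ} {S₁ S₂ : Strategy adj}
    (hS : ∀ x h, sSup ((stepOp adj f)^[N - 1 - h.length] g '' {y | adj x y}) - η
      ≤ (stepOp adj f)^[N - 1 - h.length] g (S₁.move x h)) (n : ℕ) :
    ∀ x (h : List (Bool × V)), h.length + n = N →
      (stepOp adj f)^[n] g x - n * η ≤ expectedPayoff f g S₁ S₂ n x h := by
  induction n with
  | zero => intro x h _; simp [expectedPayoff]
  | succ n ih =>
    intro x h hl
    have e1 := ih (S₁.move x h) ((true, x) :: h) (by simp; omega)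
    have e2 := ih (S₂.move x h) ((false, x) :: h) (by simp; omega)
    have e3 := hS x h
    have hN : N - 1 - h.length = n := by omega
    rw [hN] at e3
    have e4 := sInf_image_le (bounded_iterate_stepOp hrefl hf hg n)
      (show S₂.move x h ∈ {y | adj x y} from S₂.move_adj x h)
    rw [Function.iterate_succ_apply', expectedPayoff, stepOp]
    push_cast
    linarith

/-- If Player II always moves to a point which minimizes up to `η` the value of the game with the
remaining number of steps, the expected payoff exceeds the value by at most `η` per step. -/
theorem expectedPayoff_le_iterate_stepOp_add (hrefl : ∀ x, adj x x) (hf : ∃ K, ∀ x, |f x| ≤ K)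
    (hg : ∃ K, ∀ x, |g x| ≤ K) {η : ℝ} (hη : 0 ≤ η) {N : ℕ} {S₁ S₂ : Strategy adj}
    (hS : ∀ x h, (stepOp adj f)^[N - 1 - h.length] g (S₂.move x h)
      ≤ sInf ((stepOp adj f)^[N - 1 - h.length] g '' {y | adj x y}) + η) (n : ℕ) :
    ∀ x (h : List (Bool × V)), h.length + n = N →
      expectedPayoff f g S₁ S₂ n x h ≤ (stepOp adj f)^[n] g x + n * η := by
  induction n with
  | zero => intro x h _; simp [expectedPayoff]
  | succ n ih =>
    intro x h hl
    have e1 := ih (S₁.move x h) ((true, x) :: h) (by simp; omega)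
    have e2 := ih (S₂.move x h) ((false, x) :: h) (by simp; omega)
    have e3 := hS x h
    have hN : N - 1 - h.length = n := by omega
    rw [hN] at e3
    have e4 := le_sSup_image (bounded_iterate_stepOp hrefl hf hg n)
      (show S₁.move x h ∈ {y | adj x y} from S₁.move_adj x h)
    rw [Function.iterate_succ_apply', expectedPayoff, stepOp]
    push_cast
    linarith

theorem bounded_expectedPayoff (hf : ∃ K, ∀ x, |f x| ≤ K) (hg : ∃ K, ∀ x, |g x| ≤ K) (n : ℕ) :
    ∃ K, ∀ (S₁ S₂ : Strategy adj) x h, |expectedPayoff f g S₁ S₂ n x h| ≤ K := by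
  obtain ⟨F, hF⟩ := hf
  induction n with
  | zero =>
    obtain ⟨K, hK⟩ := hg
    exact ⟨K, fun S₁ S₂ x h => hK x⟩
  | succ n ih =>
    obtain ⟨K, hK⟩ := ih
    refine ⟨F + K, fun S₁ S₂ x h => ?_⟩
    have e1 := abs_le.1 (hK S₁ S₂ (S₁.move x h) ((true, x) :: h))
    have e2 := abs_le.1 (hK S₁ S₂ (S₂.move x h) ((false, x) :: h))
    have e3 := abs_le.1 (hF x)
    rw [expectedPayoff, abs_le]
    constructor <;> linarith

/-- Dynamic programming principle. -/
theorem gameValue_eq_iterate_stepOp (hrefl : ∀ x, adj x x) (hf : ∃ K, ∀ x, |f x| ≤ K)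
    (hg : ∃ K, ∀ x, |g x| ≤ K) (n : ℕ) (x : V) :
    gameValue adj f g n x = (stepOp adj f)^[n] g x := by
  have : Nonempty (Strategy adj) := ⟨⟨fun x _ => x, fun x _ => hrefl x⟩⟩
  obtain ⟨K, hK⟩ := bounded_expectedPayoff (adj := adj) hf hg n
  have hbelow (S₁ : Strategy adj) :
      BddBelow (range fun S₂ : Strategy adj => expectedPayoff f g S₁ S₂ n x []) :=
    ⟨-K, by rintro _ ⟨S₂, rfl⟩; exact (abs_le.1 (hK S₁ S₂ x [])).1⟩
  have habove : BddAbove (range fun S₁ : Strategy adj =>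
      ⨅ S₂ : Strategy adj, expectedPayoff f g S₁ S₂ n x []) :=
    ⟨K, by
      rintro _ ⟨S₁, rfl⟩
      exact (ciInf_le (hbelow S₁) (Classical.arbitrary _)).trans (abs_le.1 (hK S₁ _ x [])).2⟩
  have hlim (a b : ℝ) (h : ∀ η > 0, a ≤ b + n * η) : a ≤ b := by
    refine le_of_forall_pos_le_add fun δ hδ => (h (δ / (n + 1)) (by positivity)).trans ?_
    have : (n : ℝ) * (δ / (n + 1)) ≤ δ := by
      rw [mul_div_assoc', div_le_iff₀ (by positivity)]
      linarith
    linarith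
  apply le_antisymm
  · refine hlim _ _ fun η hη => ciSup_le fun S₁ => ?_
    have hex (x : V) (h : List (Bool × V)) :=
      exists_lt_of_sInf_image_lt (v := (stepOp adj f)^[n - 1 - h.length] g)
        (A := {y | adj x y}) ⟨x, hrefl x⟩ (lt_add_of_pos_right _ hη)
    choose m hm hm' using hex
    exact (ciInf_le (hbelow S₁) ⟨m, hm⟩).trans
      (expectedPayoff_le_iterate_stepOp_add hrefl hf hg hη.le (fun x h => (hm' x h).le) n x []
        (by simp))
  · refine hlim _ _ fun η hη => ?_
    have hex (x : V) (h : List (Bool × V)) :=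
      exists_lt_of_lt_sSup_image (v := (stepOp adj f)^[n - 1 - h.length] g)
        (A := {y | adj x y}) ⟨x, hrefl x⟩ (sub_lt_self _ hη)
    choose m hm hm' using hex
    rw [← sub_le_iff_le_add]
    exact le_trans (le_ciInf fun S₂ => iterate_stepOp_sub_le_expectedPayoff
      (S₁ := ⟨m, hm⟩) hrefl hf hg hη.le (fun x h => (hm' x h).le) n x [] (by simp))
      (le_ciSup habove ⟨m, hm⟩)

end Game

end TugOfWar

namespace TugOfWar

/-! ### Monotonicity of the game operator and comparison of its sub- and supersolutions -/

section Operator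

variable {V : Type*} {adj : V → V → Prop} {f v w : V → ℝ}

theorem stepOp_le_add (hrefl : ∀ x, adj x x) (hv : ∃ K, ∀ x, |v x| ≤ K)
    (hw : ∃ K, ∀ x, |w x| ≤ K) {C : ℝ} (h : ∀ x, v x ≤ w x + C) (x : V) :
    stepOp adj f v x ≤ stepOp adj f w x + C := by
  have hne : {y | adj x y}.Nonempty := ⟨x, hrefl x⟩
  have h1 : sSup (v '' {y | adj x y}) ≤ sSup (w '' {y | adj x y}) + C :=
    sSup_image_le hne fun y hy => (h y).trans (by linarith [le_sSup_image hw hy])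
  have h2 : sInf (v '' {y | adj x y}) - C ≤ sInf (w '' {y | adj x y}) :=
    le_sInf_image hne fun y hy => by linarith [sInf_image_le hv hy, h y]
  unfold stepOp
  linarith

theorem stepOp_neg (f v : V → ℝ) (x : V) :
    stepOp adj (fun y => -f y) (fun y => -v y) x = -stepOp adj f v x := by
  simp only [stepOp, sSup_image_neg, sInf_image_neg]
  ring

theorem iterate_stepOp_neg (f v : V → ℝ) (n : ℕ) (x : V) :
    (stepOp adj fun y => -f y)^[n] (fun y => -v y) x = -(stepOp adj f)^[n] v x := by
  induction n generalizing x with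
  | zero => rfl
  | succ n ih =>
    rw [Function.iterate_succ_apply', Function.iterate_succ_apply', ← stepOp_neg]
    congr 1
    exact funext ih

theorem iterate_stepOp_le_add (hrefl : ∀ x, adj x x) (hf : ∃ K, ∀ x, |f x| ≤ K)
    (hv : ∃ K, ∀ x, |v x| ≤ K) (hw : ∃ K, ∀ x, |w x| ≤ K) {C : ℝ} (h : ∀ x, v x ≤ w x + C)
    (n : ℕ) (x : V) : (stepOp adj f)^[n] v x ≤ (stepOp adj f)^[n] w x + C := by
  induction n generalizing x with
  | zero => exact h x
  | succ n ih =>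
    rw [Function.iterate_succ_apply', Function.iterate_succ_apply']
    exact stepOp_le_add hrefl (bounded_iterate_stepOp hrefl hf hv n)
      (bounded_iterate_stepOp hrefl hf hw n) ih x

/-- `v` is a bounded subsolution of `v + a = stepOp adj f v`. A supersolution `w` with the constant
`b` is described by saying that `-w` is a subsolution for `-f` with the constant `-b`. -/
structure IsBoundedSubsolution (adj : V → V → Prop) (f : V → ℝ) (a : ℝ) (v : V → ℝ) : Prop where
  bounded : ∃ K, ∀ x, |v x| ≤ K
  add_le : ∀ x, v x + a ≤ stepOp adj f v x

theorem IsBoundedSubsolution.add_le_iterate (hrefl : ∀ x, adj x x) (hf : ∃ K, ∀ x, |f x| ≤ K)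
    {a : ℝ} (hv : IsBoundedSubsolution adj f a v) (n : ℕ) (x : V) :
    v x + n * a ≤ (stepOp adj f)^[n] v x := by
  induction n generalizing x with
  | zero => simp
  | succ n ih =>
    rw [Function.iterate_succ_apply']
    have h1 := stepOp_le_add (f := f) hrefl hv.bounded
      (bounded_iterate_stepOp hrefl hf hv.bounded n) (C := -(n * a))
      (fun y => by linarith [ih y]) x
    have h2 := hv.add_le x
    push_cast
    linarith

theorem IsBoundedSubsolution.iterate_neg (hrefl : ∀ x, adj x x) (hf : ∃ K, ∀ x, |f x| ≤ K)
    {b : ℝ} (hw : IsBoundedSubsolution adj (fun y => -f y) b w) (n : ℕ) (x : V) :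
    (stepOp adj f)^[n] (fun y => -w y) x ≤ -w x - n * b := by
  have h1 := hw.add_le_iterate hrefl (bounded_neg hf) n x
  have h2 := iterate_stepOp_neg (adj := adj) f (fun y => -w y) n x
  simp only [neg_neg] at h2
  linarith

theorem nonpos_of_nat_mul_le {a C : ℝ} (h : ∀ n : ℕ, n * a ≤ C) : a ≤ 0 := by
  by_contra! ha
  obtain ⟨n, hn⟩ := exists_nat_gt (C / a)
  rw [div_lt_iff₀ ha] at hn
  linarith [h n]

/-- The constant of a subsolution is at most that of a supersolution. -/
theorem IsBoundedSubsolution.add_nonpos [Nonempty V] (hrefl : ∀ x, adj x x)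
    (hf : ∃ K, ∀ x, |f x| ≤ K) {a b : ℝ} (hv : IsBoundedSubsolution adj f a v)
    (hw : IsBoundedSubsolution adj (fun y => -f y) b w) : a + b ≤ 0 := by
  obtain ⟨x⟩ := ‹Nonempty V›
  obtain ⟨K, hK⟩ := hv.bounded
  obtain ⟨K', hK'⟩ := hw.bounded
  refine nonpos_of_nat_mul_le (C := 2 * K + 2 * K') fun n => ?_
  have h1 := hv.add_le_iterate hrefl hf n x
  have h2 := hw.iterate_neg hrefl hf n x
  have h3 := iterate_stepOp_le_add hrefl hf hv.bounded (bounded_neg hw.bounded) (C := K + K')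
    (fun y => by linarith [(abs_le.1 (hK y)).2, (abs_le.1 (hK' y)).2]) n x
  have h4 := abs_le.1 (hK x)
  have h5 := abs_le.1 (hK' x)
  linarith

/-- If the `N`-step value is at least `N * a`, then the maximum over `n < N` of the `n`-step values
minus `n * a` is a subsolution. -/
theorem exists_isBoundedSubsolution_of_iterate (hrefl : ∀ x, adj x x) (hf : ∃ K, ∀ x, |f x| ≤ K)
    {a : ℝ} {N : ℕ} (hN : 0 < N) (h : ∀ x, N * a ≤ (stepOp adj f)^[N] (fun _ => 0) x) :
    ∃ v, IsBoundedSubsolution adj f a v := by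
  have hne : (Finset.range N).Nonempty := Finset.nonempty_range_iff.2 hN.ne'
  set u : ℕ → V → ℝ := fun n => (stepOp adj f)^[n] fun _ => 0 with hu
  have hub (n : ℕ) : ∃ K, ∀ x, |u n x| ≤ K :=
    bounded_iterate_stepOp hrefl hf ⟨0, fun _ => by simp⟩ n
  set v : V → ℝ := fun x => (Finset.range N).sup' hne fun n => u n x - n * a with hv
  have hle {n : ℕ} (hn : n < N) (x : V) : u n x - n * a ≤ v x :=
    Finset.le_sup' (fun n : ℕ => u n x - n * a) (Finset.mem_range.2 hn)
  have heq (x : V) : ∃ n < N, v x = u n x - n * a := by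
    obtain ⟨n, hn, h⟩ := Finset.exists_mem_eq_sup' hne fun n : ℕ => u n x - n * a
    exact ⟨n, Finset.mem_range.1 hn, h⟩
  have hvb : ∃ K, ∀ x, |v x| ≤ K := by
    choose K hK using hub
    refine ⟨∑ n ∈ Finset.range N, (|K n| + n * |a|), fun x => ?_⟩
    obtain ⟨n, hn, h⟩ := heq x
    have h1 : |u n x - n * a| ≤ |K n| + n * |a| := by
      refine (abs_sub _ _).trans ?_
      rw [abs_mul, Nat.abs_cast]
      linarith [hK n x, le_abs_self (K n)]
    rw [h]
    exact h1.trans (Finset.single_le_sum (f := fun n : ℕ => |K n| + n * |a|)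
      (fun _ _ => by positivity) (Finset.mem_range.2 hn))
  have hstep {n : ℕ} (hn : n < N) (x : V) : u (n + 1) x - n * a ≤ stepOp adj f v x := by
    have h1 := stepOp_le_add (f := f) hrefl (hub n) hvb (C := n * a)
      (fun y => by linarith [hle hn y]) x
    simp only [hu, Function.iterate_succ_apply'] at h1 ⊢
    linarith
  refine ⟨v, hvb, fun x => ?_⟩
  obtain ⟨n, hn, hx⟩ := heq x
  rcases n with _ | n
  · have h1 := hstep (Nat.sub_lt hN one_pos) x
    rw [Nat.sub_add_cancel (Nat.one_le_iff_ne_zero.2 hN.ne'), Nat.cast_pred hN] at h1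
    have h2 := h x
    have h3 : u 0 x = 0 := rfl
    simp only [h3] at hx
    push_cast at h1 hx
    simp only [hu] at h1
    linarith
  · have h1 := hstep (Nat.lt_of_succ_lt hn) x
    push_cast at hx
    linarith

theorem isLongTermAdvantage_iff (hrefl : ∀ x, adj x x) (hf : ∃ K, ∀ x, |f x| ≤ K) {c : ℝ} :
    IsLongTermAdvantage adj f c ↔ ∀ g : V → ℝ, (∃ K, ∀ x, |g x| ≤ K) →
      ∃ C, ∀ (n : ℕ) (x : V), |(stepOp adj f)^[n] g x - n * c| ≤ C := by
  refine forall₂_congr fun g hg => ?_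
  simp only [gameValue_eq_iterate_stepOp hrefl hf hg]

theorem IsLongTermAdvantage.neg (hrefl : ∀ x, adj x x) (hf : ∃ K, ∀ x, |f x| ≤ K) {c : ℝ}
    (hc : IsLongTermAdvantage adj f c) : IsLongTermAdvantage adj (fun x => -f x) (-c) := by
  rw [isLongTermAdvantage_iff hrefl (bounded_neg hf)]
  rw [isLongTermAdvantage_iff hrefl hf] at hc
  intro g hg
  obtain ⟨C, hC⟩ := hc (fun x => -g x) (bounded_neg hg)
  refine ⟨C, fun n x => ?_⟩
  have h := iterate_stepOp_neg (adj := adj) f (fun y => -g y) n x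
  simp only [neg_neg] at h
  rw [h, ← abs_neg]
  convert hC n x using 2
  ring

theorem IsBoundedSubsolution.le [Nonempty V] (hrefl : ∀ x, adj x x) (hf : ∃ K, ∀ x, |f x| ≤ K)
    {a c : ℝ} (hc : IsLongTermAdvantage adj f c) (hv : IsBoundedSubsolution adj f a v) :
    a ≤ c := by
  obtain ⟨x⟩ := ‹Nonempty V›
  obtain ⟨C, hC⟩ := (isLongTermAdvantage_iff hrefl hf).1 hc v hv.bounded
  rw [← sub_nonpos]
  refine nonpos_of_nat_mul_le (C := C - v x) fun n => ?_
  linarith [hv.add_le_iterate hrefl hf n x, (abs_le.1 (hC n x)).2]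

theorem IsLongTermAdvantage.exists_isBoundedSubsolution (hrefl : ∀ x, adj x x)
    (hf : ∃ K, ∀ x, |f x| ≤ K) {a c : ℝ} (hc : IsLongTermAdvantage adj f c) (ha : a < c) :
    ∃ v, IsBoundedSubsolution adj f a v := by
  obtain ⟨C, hC⟩ := (isLongTermAdvantage_iff hrefl hf).1 hc (fun _ => 0) ⟨0, fun _ => by simp⟩
  obtain ⟨N, hN⟩ := exists_nat_gt (C / (c - a))
  rw [div_lt_iff₀ (sub_pos.2 ha)] at hN
  refine exists_isBoundedSubsolution_of_iterate hrefl hf N.succ_pos fun x => ?_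
  have h1 := (abs_le.1 (hC (N + 1) x)).1
  push_cast at h1 ⊢
  linarith

end Operator

/-! ### Games on bounded geodesic spaces -/

/-- `ρ` is a pseudometric on `X` bounded by `R`, in which any two points at distance at most
`s + t` have a point in between, at distances at most `s` and `t`. -/
structure IsBoundedGeodesic {X : Type*} (ρ : X → X → ℝ) (R : ℝ) : Prop where
  self : ∀ x, ρ x x = 0
  symm : ∀ x y, ρ x y = ρ y x
  triangle : ∀ x y z, ρ x z ≤ ρ x y + ρ y z
  split : ∀ x y s t, 0 ≤ s → 0 ≤ t → ρ x y ≤ s + t → ∃ z, ρ x z ≤ s ∧ ρ z y ≤ t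
  bound : ∀ x y, ρ x y ≤ R

namespace IsBoundedGeodesic

variable {X : Type*} {ρ : X → X → ℝ} {R : ℝ} {f v : X → ℝ} {a δ ε : ℝ}

theorem refl (hρ : IsBoundedGeodesic ρ R) (hε : 0 ≤ ε) (x : X) : ρ x x ≤ ε := by
  rwa [hρ.self]

/-- A bound on the increments of a function along steps of length `ε` accumulates along chains. -/
theorem sub_le_nat_mul (hρ : IsBoundedGeodesic ρ R) (hε : 0 ≤ ε) {S : ℝ}
    (hS : ∀ x y, ρ x y ≤ ε → v y - v x ≤ S) (n : ℕ) :
    ∀ x y, ρ x y ≤ (n + 1 : ℕ) * ε → v y - v x ≤ (n + 1 : ℕ) * S := by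
  induction n with
  | zero => simpa using hS
  | succ n ih =>
    intro x y hxy
    obtain ⟨z, h1, h2⟩ := hρ.split x y ((n + 1 : ℕ) * ε) ε (by positivity) hε
      (by push_cast at hxy ⊢; linarith)
    have h3 := ih x z h1
    have h4 := hS z y h2
    push_cast at h3 ⊢
    linarith

/-- Starting from `x` and moving each time to a neighbour where a subsolution is almost maximal, the
increments of the subsolution decrease by at most `2 * H` per step. -/
theorem exists_climb (hρ : IsBoundedGeodesic ρ R) (hε : 0 ≤ ε)
    (hv : IsBoundedSubsolution (fun x y => ρ x y ≤ ε) f a v) {H : ℝ} (hH₀ : 0 ≤ H)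
    (hH : ∀ x, f x - a ≤ H) {s : ℝ} {x : X} (hs : s < sSup (v '' {y | ρ x y ≤ ε}) - v x) (k : ℕ) :
    ∃ y, v x + k * s - k ^ 2 * H ≤ v y ∧
      s - 2 * H * k < sSup (v '' {z | ρ y z ≤ ε}) - v y := by
  induction k with
  | zero => exact ⟨x, by simp, by simpa using hs⟩
  | succ k ih =>
    obtain ⟨y, h1, h2⟩ := ih
    obtain ⟨z, hz, h3⟩ := exists_lt_of_lt_sSup_image
      (A := {z | ρ y z ≤ ε}) ⟨y, hρ.refl hε y⟩ (lt_sub_iff_add_lt.1 h2)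
    have h4 := sInf_image_le hv.bounded
      (show y ∈ {y | ρ z y ≤ ε} from (hρ.symm z y).trans_le hz)
    have h5 := hv.add_le z
    have h6 := hH z
    unfold stepOp at h5
    refine ⟨z, ?_, ?_⟩ <;> push_cast <;> nlinarith

/-- Discrete Lipschitz estimate for subsolutions: climbing for `2 * D` steps, where `D` bounds the
diameter in steps, would otherwise increase the subsolution by more than its oscillation. -/
theorem sub_le_of_isBoundedSubsolution (hρ : IsBoundedGeodesic ρ R) (hε : 0 ≤ ε)
    (hv : IsBoundedSubsolution (fun x y => ρ x y ≤ ε) f a v) {H : ℝ} (hH₀ : 0 ≤ H)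
    (hH : ∀ x, f x - a ≤ H) {D : ℕ} (hD₀ : 0 < D) (hD : R ≤ D * ε) {x y : X}
    (hxy : ρ x y ≤ ε) : v y - v x ≤ 4 * D * H := by
  set gap : X → ℝ := fun x => sSup (v '' {y | ρ x y ≤ ε}) - v x with hgap
  have hbdd : BddAbove (range gap) := by
    obtain ⟨K, hK⟩ := hv.bounded
    refine ⟨K + K, ?_⟩
    rintro _ ⟨x, rfl⟩
    have h1 := sSup_image_le (v := v) (A := {y | ρ x y ≤ ε}) ⟨x, hρ.refl hε x⟩
      fun y _ => (abs_le.1 (hK y)).2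
    have h2 := (abs_le.1 (hK x)).1
    simp only [hgap]
    linarith
  have hgap_le (x y : X) (h : ρ x y ≤ ε) : v y - v x ≤ gap x :=
    sub_le_sub_right (le_sSup_image hv.bounded h) _
  have : Nonempty X := ⟨x⟩
  have hosc (x y : X) : v y - v x ≤ D * ⨆ x, gap x := by
    obtain ⟨n, rfl⟩ := Nat.exists_eq_succ_of_ne_zero hD₀.ne'
    exact hρ.sub_le_nat_mul hε (fun x y h => (hgap_le x y h).trans (le_ciSup hbdd x)) n x y
      ((hρ.bound x y).trans hD)
  have hD' : (0 : ℝ) < D := by exact_mod_cast hD₀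
  have hsup : ⨆ x, gap x ≤ (⨆ x, gap x) / 2 + 2 * D * H := by
    refine ciSup_le fun x => le_of_forall_lt fun s hs => ?_
    obtain ⟨s', hss', hs'⟩ := exists_between hs
    refine hss'.trans_le ?_
    obtain ⟨y, h1, -⟩ := hρ.exists_climb hε hv hH₀ hH hs' (2 * D)
    have h2 := hosc x y
    push_cast at h1
    refine le_of_mul_le_mul_left (a := 2 * (D : ℝ)) ?_ (by positivity)
    linarith
  linarith [hgap_le x y hxy, le_ciSup hbdd x]

theorem exists_nat_mul_ge (R : ℝ) (hε : 0 < ε) : ∃ D : ℕ, 0 < D ∧ R ≤ D * ε := by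
  obtain ⟨D, hD⟩ := exists_nat_gt (R / ε)
  rw [div_lt_iff₀ hε] at hD
  refine ⟨D + 1, D.succ_pos, ?_⟩
  push_cast
  linarith

/-- The value of the `n`-step game has an oscillation which is bounded in `n`. -/
theorem exists_iterate_stepOp_sub_le (hρ : IsBoundedGeodesic ρ R) (hε : 0 < ε)
    (hf : ∃ K, ∀ x, |f x| ≤ K) : ∃ K, 0 ≤ K ∧ ∀ n x y,
      (stepOp (fun x y => ρ x y ≤ ε) f)^[n] (fun _ => 0) y
        - (stepOp (fun x y => ρ x y ≤ ε) f)^[n] (fun _ => 0) x ≤ K := by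
  obtain ⟨F, hF⟩ := id hf
  obtain ⟨D, hD₀, hD⟩ := exists_nat_mul_ge R hε
  have hrefl := hρ.refl hε.le
  have h0 : ∃ K, ∀ x : X, |(fun _ => 0 : X → ℝ) x| ≤ K := ⟨0, fun _ => by simp⟩
  refine ⟨D * (4 * D * (2 * |F|)), by positivity, fun n => ?_⟩
  -- Consecutive values differ by at most `F`, because the first two do.
  have hsub : IsBoundedSubsolution (fun x y => ρ x y ≤ ε) f (-|F|)
      ((stepOp (fun x y => ρ x y ≤ ε) f)^[n] fun _ => 0) := by
    refine ⟨bounded_iterate_stepOp hrefl hf h0 n, fun x => ?_⟩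
    have h1 : ∀ x,
        (fun _ => 0 : X → ℝ) x ≤ stepOp (fun x y => ρ x y ≤ ε) f (fun _ => 0) x + |F| := by
      intro x
      have hne : {y | ρ x y ≤ ε}.Nonempty := ⟨x, hrefl x⟩
      have := (abs_le.1 (hF x)).1
      simp only [stepOp, hne.image_const, csSup_singleton, csInf_singleton]
      linarith [le_abs_self F]
    have h2 := iterate_stepOp_le_add (adj := fun x y => ρ x y ≤ ε) hrefl hf h0 
      (bounded_stepOp hrefl hf h0) h1 n x
    rw [← Function.iterate_succ_apply, Function.iterate_succ_apply'] at h2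
    linarith
  obtain ⟨m, rfl⟩ := Nat.exists_eq_succ_of_ne_zero hD₀.ne'
  intro x y
  refine hρ.sub_le_nat_mul hε.le (fun x y h => hρ.sub_le_of_isBoundedSubsolution hε.le hsub
    (by positivity) (fun x => ?_) hD₀ hD h) m x y ((hρ.bound x y).trans hD)
  linarith [(abs_le.1 (hF x)).2, le_abs_self F]

/-- The long term advantage exists. It is the supremum of the constants of subsolutions. -/
theorem exists_isLongTermAdvantage [Nonempty X] (hρ : IsBoundedGeodesic ρ R) (hε : 0 < ε)
    (hf : ∃ K, ∀ x, |f x| ≤ K) : ∃ c, IsLongTermAdvantage (fun x y => ρ x y ≤ ε) f c := by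
  have hrefl := hρ.refl hε.le
  obtain ⟨K, hK₀, hK⟩ := hρ.exists_iterate_stepOp_sub_le hε hf
  set u : ℕ → X → ℝ := fun n => (stepOp (fun x y => ρ x y ≤ ε) f)^[n] fun _ => 0 with hu
  have h0 : ∃ K, ∀ x : X, |(fun _ => 0 : X → ℝ) x| ≤ K := ⟨0, fun _ => by simp⟩
  have hlow (N : ℕ) (hN : 0 < N) (x : X) :
      ∃ v, IsBoundedSubsolution (fun x y => ρ x y ≤ ε) f ((u N x - K) / N) v := by
    refine exists_isBoundedSubsolution_of_iterate hrefl hf hN fun y => ?_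
    rw [mul_div_cancel₀ _ (by positivity)]
    linarith [hK N y x]
  have hupp (N : ℕ) (hN : 0 < N) (x : X) :
      ∃ v, IsBoundedSubsolution (fun x y => ρ x y ≤ ε) (fun y => -f y) ((-u N x - K) / N) v := by
    refine exists_isBoundedSubsolution_of_iterate hrefl (bounded_neg hf) hN fun y => ?_
    have h := iterate_stepOp_neg (adj := fun x y => ρ x y ≤ ε) f (fun _ => 0) N y
    rw [neg_zero] at h
    rw [h, mul_div_cancel₀ _ (by positivity)]
    linarith [hK N x y]
  set A : Set ℝ := {a | ∃ v, IsBoundedSubsolution (fun x y => ρ x y ≤ ε) f a v} with hA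
  have hle (N : ℕ) (hN : 0 < N) (x : X) : ∀ a ∈ A, a ≤ (u N x + K) / N := by
    rintro a ⟨v, hv⟩
    obtain ⟨w, hw⟩ := hupp N hN x
    have := hv.add_nonpos hrefl hf hw
    rw [← neg_add', neg_div] at this
    linarith
  obtain ⟨x₀⟩ := ‹Nonempty X›
  have hAne : A.Nonempty := ⟨_, hlow 1 one_pos x₀⟩
  have hAbdd : BddAbove A := ⟨_, hle 1 one_pos x₀⟩
  refine ⟨sSup A, (isLongTermAdvantage_iff hrefl hf).2 fun g hg => ?_⟩
  obtain ⟨G, hG⟩ := id hg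
  have hKc (n : ℕ) (x : X) : |u n x - n * sSup A| ≤ K := by
    rcases Nat.eq_zero_or_pos n with rfl | hn
    · simpa [hu] using hK₀
    · have hn' : (0 : ℝ) < n := by exact_mod_cast hn
      have h1 := le_csSup hAbdd (hlow n hn x)
      have h2 := csSup_le hAne (hle n hn x)
      rw [div_le_iff₀ hn'] at h1
      rw [le_div_iff₀ hn'] at h2
      rw [abs_le]
      constructor <;> linarith
  refine ⟨K + G, fun n x => ?_⟩
  have h1 := abs_le.1 (hKc n x)
  have h2 := iterate_stepOp_le_add (adj := fun x y => ρ x y ≤ ε) hrefl hf hg h0 (C := G)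
    (fun y => by linarith [(abs_le.1 (hG y)).2]) n x
  have h3 := iterate_stepOp_le_add (adj := fun x y => ρ x y ≤ ε) hrefl hf h0 hg (C := G)
    (fun y => by linarith [(abs_le.1 (hG y)).1]) n x
  simp only [hu] at h1
  rw [abs_le]
  constructor <;> linarith

/-! ### Comparison of step sizes -/

theorem second_difference_le {b : ℕ → ℝ} {h : ℝ} {m : ℕ}
    (hb : ∀ i, i + 2 ≤ 2 * m → -(2 * h) ≤ b (i + 2) + b i - 2 * b (i + 1)) :
    -(2 * h * m ^ 2) ≤ b (2 * m) + b 0 - 2 * b m := by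
  have h1 (k i : ℕ) (hk : i + k + 1 ≤ 2 * m) :
      b (i + 1) - b i - 2 * h * k ≤ b (i + k + 1) - b (i + k) := by
    induction k with
    | zero => simp
    | succ k ih =>
      have h2 := ih (by omega)
      have h3 := hb (i + k) (by omega)
      push_cast
      simp only [← add_assoc] at *
      linarith
  have h2 (j : ℕ) (hj : j ≤ m) : b j - b 0 - 2 * h * m * j ≤ b (j + m) - b m := by
    induction j with
    | zero => simp
    | succ j ih =>
      have h3 := ih (by omega)
      have h4 := h1 m j (by omega)
      rw [show j + 1 + m = j + m + 1 by ring]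
      push_cast
      linarith
  have h3 := h2 m le_rfl
  rw [← two_mul] at h3
  linarith

/-- The maximum `M t` of a subsolution over the balls of radius `t` around `x` is semiconvex along
steps of length `ε` in `t`. -/
theorem semiconvex_sSup_ball (hρ : IsBoundedGeodesic ρ R) (hε : 0 ≤ ε)
    (hv : IsBoundedSubsolution (fun x y => ρ x y ≤ ε) f a v) {x : X} {t h : ℝ} (ht : ε ≤ t)
    (hf : ∀ y, ρ x y ≤ t → f y ≤ h + a) :
    -(2 * h) ≤ sSup (v '' {y | ρ x y ≤ t + ε}) + sSup (v '' {y | ρ x y ≤ t - ε})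
      - 2 * sSup (v '' {y | ρ x y ≤ t}) := by
  refine le_of_forall_pos_le_add fun η hη => ?_
  have ht0 : 0 ≤ t := hε.trans ht
  obtain ⟨y, hy, h1⟩ := exists_lt_of_lt_sSup_image (v := v) (A := {y | ρ x y ≤ t})
    ⟨x, hρ.refl ht0 x⟩ (sub_lt_self _ (half_pos hη))
  obtain ⟨z, hz, hzy⟩ := hρ.split x y (t - ε) ε (sub_nonneg.2 ht) hε (by simpa using hy)
  have h2 : sSup (v '' {z | ρ y z ≤ ε}) ≤ sSup (v '' {y | ρ x y ≤ t + ε}) :=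
    sSup_image_le ⟨y, hρ.refl hε y⟩ fun w hw => le_sSup_image hv.bounded
      ((hρ.triangle x y w).trans (add_le_add hy hw))
  have h3 := sInf_image_le hv.bounded
    (show z ∈ {z | ρ y z ≤ ε} from (hρ.symm y z).trans_le hzy)
  have h4 := le_sSup_image hv.bounded (show z ∈ {y | ρ x y ≤ t - ε} from hz)
  have h5 := hv.add_le y
  have h6 := hf y hy
  unfold stepOp at h5
  linarith

/-- A subsolution for the step size `ε` gives a subsolution for a larger step size `δ`, by taking
maxima over the balls of radius `δ`. -/
theorem exists_isBoundedSubsolution_of_le (hρ : IsBoundedGeodesic ρ R) (hε : 0 < ε)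
    (hv : IsBoundedSubsolution (fun x y => ρ x y ≤ ε) f a v) {H : ℝ} (hH₀ : 0 ≤ H)
    (hH : ∀ x, f x - a ≤ H) {D : ℕ} (hD₀ : 0 < D) (hD : R ≤ D * ε) {m : ℕ} (hm : 0 < m)
    (hmδ : m * ε ≤ δ) (hδm : δ ≤ (m + 1) * ε) {τ : ℝ}
    (hτ : ∀ x y, ρ x y ≤ 2 * δ → f y ≤ f x + τ) :
    ∃ w, IsBoundedSubsolution (fun x y => ρ x y ≤ δ) f (a - τ - 2 * D * H / m ^ 2) w := by
  have hm' : (0 : ℝ) < m := by exact_mod_cast hm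
  have hδ : 0 ≤ δ := le_trans (by positivity) hmδ
  set M : ℝ → X → ℝ := fun t x => sSup (v '' {y | ρ x y ≤ t}) with hM
  have hMb (t : ℝ) (ht : 0 ≤ t) : ∃ K, ∀ x, |M t x| ≤ K := by
    obtain ⟨K, hK⟩ := hv.bounded
    refine ⟨K, fun x => abs_le.2 ⟨?_, ?_⟩⟩
    · exact (abs_le.1 (hK x)).1.trans (le_sSup_image hv.bounded (hρ.refl ht x))
    · exact sSup_image_le ⟨x, hρ.refl ht x⟩ fun y _ => (abs_le.1 (hK y)).2
  have hwb : ∃ K, ∀ x, |M δ x / m ^ 2| ≤ K := by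
    obtain ⟨K, hK⟩ := hMb δ hδ
    refine ⟨K / m ^ 2, fun x => ?_⟩
    rw [abs_div, abs_of_pos (by positivity : (0 : ℝ) < m ^ 2)]
    exact div_le_div_of_nonneg_right (hK x) (by positivity)
  refine ⟨fun x => M δ x / m ^ 2, hwb, fun x => ?_⟩
  -- The radii `δ - m * ε + i * ε`, for `i = 0, …, 2 * m`, run up to at most `2 * δ`.
  set r : ℝ := δ - m * ε with hr
  have hr0 : 0 ≤ r := sub_nonneg.2 hmδ
  have hrε : r ≤ ε := by linarith
  have h1 := second_difference_le (b := fun i => M (r + i * ε) x) (h := f x + τ - a) (m := m)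
    fun i hi => by
      have hi' : (i + 2 : ℝ) ≤ 2 * m := by exact_mod_cast hi
      have := hρ.semiconvex_sSup_ball hε.le hv (x := x) (t := r + (i + 1 : ℕ) * ε)
        (h := f x + τ - a) (by push_cast; nlinarith) fun y hy => by
          rw [sub_add_cancel]
          refine hτ x y (hy.trans ?_)
          push_cast
          nlinarith
      convert this using 2
      · congr 1
        · simp only [hM]; congr 4; ext y; push_cast; ring_nf
        · simp only [hM]; congr 4; ext y; push_cast; ring_nf
  have e1 : r + m * ε = δ := by simp [hr]
  simp only [e1, Nat.cast_zero, zero_mul, add_zero] at h1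
  have h2 : M (r + (2 * m : ℕ) * ε) x
      ≤ m ^ 2 * sSup ((fun x => M δ x / m ^ 2) '' {y | ρ x y ≤ δ}) := by
    refine sSup_image_le ⟨x, hρ.refl (by positivity) x⟩ fun y hy => ?_
    obtain ⟨z, hz, hzy⟩ := hρ.split x y δ δ hδ hδ (le_trans hy (by push_cast; linarith))
    have h3 := le_sSup_image hwb (show z ∈ {y | ρ x y ≤ δ} from hz)
    rw [div_le_iff₀' (by positivity)] at h3
    exact (le_sSup_image hv.bounded (show y ∈ {y | ρ z y ≤ δ} from hzy)).trans h3
  have h3 : v x / m ^ 2 ≤ sInf ((fun x => M δ x / m ^ 2) '' {y | ρ x y ≤ δ}) := by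
    refine le_sInf_image ⟨x, hρ.refl hδ x⟩ fun y hy => ?_
    refine div_le_div_of_nonneg_right (le_sSup_image hv.bounded ?_) (by positivity)
    exact (hρ.symm y x).trans_le hy
  rw [div_le_iff₀' (by positivity)] at h3
  have h4 : M r x ≤ v x + 4 * D * H := by
    refine sSup_image_le ⟨x, hρ.refl hr0 x⟩ fun y hy => ?_
    linarith [hρ.sub_le_of_isBoundedSubsolution hε.le hv hH₀ hH hD₀ hD (le_trans hy hrε)]
  unfold stepOp
  refine le_of_mul_le_mul_left (a := 2 * (m : ℝ) ^ 2) ?_ (by positivity)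
  have e2 : 2 * (m : ℝ) ^ 2 * (M δ x / m ^ 2 + (a - τ - 2 * D * H / m ^ 2))
      = 2 * M δ x + 2 * m ^ 2 * (a - τ) - 4 * D * H := by
    field_simp
    ring
  rw [e2]
  linarith

/-- The long term advantages for a step size and a much smaller one almost agree, from below. -/
theorem sub_le_of_isLongTermAdvantage [Nonempty X] (hρ : IsBoundedGeodesic ρ R) (hε : 0 < ε)
    {F : ℝ} (hF : ∀ x, |f x| ≤ F) {D : ℕ} (hD₀ : 0 < D) (hD : R ≤ D * ε) {m : ℕ} (hm : 0 < m)
    (hmδ : m * ε ≤ δ) (hδm : δ ≤ (m + 1) * ε) {τ : ℝ}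
    (hτ : ∀ x y, ρ x y ≤ 2 * δ → |f y - f x| ≤ τ) {c c' : ℝ}
    (hc : IsLongTermAdvantage (fun x y => ρ x y ≤ ε) f c)
    (hc' : IsLongTermAdvantage (fun x y => ρ x y ≤ δ) f c') :
    c - (τ + 2 * D * (2 * F + 1) / m ^ 2) ≤ c' := by
  have hm' : (0 : ℝ) < m := by exact_mod_cast hm
  have hδ : 0 ≤ δ := le_trans (by positivity) hmδ
  obtain ⟨x₀⟩ := id ‹Nonempty X›
  have hF0 : 0 ≤ F := (abs_nonneg _).trans (hF x₀)
  have hcF : -F ≤ c := by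
    refine IsBoundedSubsolution.le (v := fun _ => 0) (hρ.refl hε.le) ⟨F, hF⟩ hc
      ⟨⟨0, fun _ => by simp⟩, fun x => ?_⟩
    have hne : {y | ρ x y ≤ ε}.Nonempty := ⟨x, hρ.refl hε.le x⟩
    simp only [stepOp, hne.image_const, csSup_singleton, csInf_singleton]
    linarith [(abs_le.1 (hF x)).1]
  refine le_of_forall_pos_le_add fun η hη => ?_
  obtain ⟨v, hv⟩ := hc.exists_isBoundedSubsolution (hρ.refl hε.le) ⟨F, hF⟩
    (sub_lt_self c (lt_min hη one_pos))
  obtain ⟨w, hw⟩ := hρ.exists_isBoundedSubsolution_of_le hε hv (H := 2 * F + 1) (by positivity)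
    (fun x => by linarith [(abs_le.1 (hF x)).2, min_le_right η 1]) hD₀ hD hm hmδ hδm (τ := τ)
    (fun x y h => by linarith [(abs_le.1 (hτ x y h)).2])
  linarith [hw.le (hρ.refl hδ) ⟨F, hF⟩ hc', min_le_left η 1]

theorem abs_sub_le_of_isLongTermAdvantage [Nonempty X] (hρ : IsBoundedGeodesic ρ R) (hε : 0 < ε)
    {F : ℝ} (hF : ∀ x, |f x| ≤ F) {D : ℕ} (hD₀ : 0 < D) (hD : R ≤ D * ε) {m : ℕ} (hm : 0 < m)
    (hmδ : m * ε ≤ δ) (hδm : δ ≤ (m + 1) * ε) {τ : ℝ}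
    (hτ : ∀ x y, ρ x y ≤ 2 * δ → |f y - f x| ≤ τ) {c c' : ℝ}
    (hc : IsLongTermAdvantage (fun x y => ρ x y ≤ ε) f c)
    (hc' : IsLongTermAdvantage (fun x y => ρ x y ≤ δ) f c') :
    |c - c'| ≤ τ + 2 * D * (2 * F + 1) / m ^ 2 := by
  have hδ : 0 ≤ δ := le_trans (by positivity) hmδ
  have h1 := hρ.sub_le_of_isLongTermAdvantage hε hF hD₀ hD hm hmδ hδm hτ hc hc'
  have h2 := hρ.sub_le_of_isLongTermAdvantage hε (f := fun x => -f x)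
    (fun x => by simpa using hF x) hD₀ hD hm hmδ hδm
    (fun x y h => by rw [neg_sub_neg, abs_sub_comm]; exact hτ x y h)
    (hc.neg (hρ.refl hε.le) ⟨F, hF⟩) (hc'.neg (hρ.refl hδ) ⟨F, hF⟩)
  rw [abs_le]
  constructor <;> linarith

/-- The long term advantage converges as the step size tends to `0`. -/
theorem exists_tendsto_longTermAdvantage [Nonempty X] (hρ : IsBoundedGeodesic ρ R)
    (hf : ∃ K, ∀ x, |f x| ≤ K)
    (hfu : ∀ η > 0, ∃ δ > 0, ∀ x y, ρ x y ≤ δ → |f y - f x| ≤ η) {c : ℝ → ℝ}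
    (hc : ∀ ε > 0, IsLongTermAdvantage (fun x y => ρ x y ≤ ε) f (c ε)) :
    ∃ l, Tendsto c (𝓝[>] 0) (𝓝 l) := by
  obtain ⟨F, hF⟩ := hf
  obtain ⟨x₀⟩ := id ‹Nonempty X›
  have hF0 : 0 ≤ F := (abs_nonneg _).trans (hF x₀)
  have hR : 0 ≤ R := by simpa [hρ.self] using hρ.bound x₀ x₀
  rw [← cauchy_map_iff_exists_tendsto, Metric.cauchy_iff]
  refine ⟨inferInstance, fun η hη => ?_⟩
  obtain ⟨δ', hδ', hτ⟩ := hfu (η / 4) (by positivity)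
  set δ := δ' / 2 with hδdef
  have hδ : 0 < δ := half_pos hδ'
  -- With `D ≤ R / ε + 2` and `m ≥ δ / (2 * ε)` the error is at most this expression in `ε`.
  have hlim : Tendsto (fun ε : ℝ => 8 * (2 * F + 1) * (R * ε + 2 * ε ^ 2) / δ ^ 2)
      (𝓝[>] 0) (𝓝 0) := by
    have : Continuous fun ε : ℝ => 8 * (2 * F + 1) * (R * ε + 2 * ε ^ 2) / δ ^ 2 := by fun_prop
    simpa using (this.tendsto 0).mono_left nhdsWithin_le_nhds
  have hev : ∀ᶠ ε in 𝓝[>] (0 : ℝ), |c ε - c δ| < η / 2 := by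
    filter_upwards [hlim.eventually (gt_mem_nhds (show 0 < η / 4 by positivity)),
      self_mem_nhdsWithin, Ioc_mem_nhdsGT (show 0 < δ / 2 by positivity)] with ε h1 (hε : 0 < ε) h2
    have hm1 : (⌊δ / ε⌋₊ : ℝ) ≤ δ / ε := Nat.floor_le (by positivity)
    have hm2 : δ / ε < ⌊δ / ε⌋₊ + 1 := Nat.lt_floor_add_one _
    have hD1 : R / ε ≤ ⌈R / ε⌉₊ := Nat.le_ceil _
    have hD2 : (⌈R / ε⌉₊ : ℝ) < R / ε + 1 := Nat.ceil_lt_add_one (by positivity)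
    have hε2 : 2 ≤ δ / ε := by
      rw [le_div_iff₀ hε]
      linarith [h2.2]
    have hm3 : δ / (2 * ε) ≤ ⌊δ / ε⌋₊ := by
      have : δ / (2 * ε) = (δ / ε) / 2 := by field_simp
      linarith
    have hm0 : 0 < ⌊δ / ε⌋₊ := by
      have : (0 : ℝ) < ⌊δ / ε⌋₊ := by linarith
      exact_mod_cast this
    have h3 := hρ.abs_sub_le_of_isLongTermAdvantage hε hF (D := ⌈R / ε⌉₊ + 1) (Nat.succ_pos _)
      (by
        rw [div_le_iff₀ hε] at hD1
        push_cast
        linarith) hm0 (by rwa [← le_div_iff₀ hε])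
      (by rw [← div_le_iff₀ hε]; exact hm2.le)
      (fun x y h => hτ x y (h.trans_eq (by rw [hδdef]; ring))) (hc ε hε) (hc δ hδ)
    refine h3.trans_lt ?_
    have h4 : 2 * ((⌈R / ε⌉₊ + 1 : ℕ) : ℝ) * (2 * F + 1) / (⌊δ / ε⌋₊ : ℝ) ^ 2
        ≤ 2 * (R / ε + 2) * (2 * F + 1) / (δ / (2 * ε)) ^ 2 := by
      gcongr
      push_cast
      linarith
    have h5 : 2 * (R / ε + 2) * (2 * F + 1) / (δ / (2 * ε)) ^ 2
        = 8 * (2 * F + 1) * (R * ε + 2 * ε ^ 2) / δ ^ 2 := by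
      field_simp
      ring
    linarith
  refine ⟨_, image_mem_map hev, ?_⟩
  rintro _ ⟨ε₁, h1, rfl⟩ _ ⟨ε₂, h2, rfl⟩
  rw [Real.dist_eq]
  have h1' := abs_lt.1 (show |c ε₁ - c δ| < η / 2 from h1)
  have h2' := abs_lt.1 (show |c ε₂ - c δ| < η / 2 from h2)
  rw [abs_lt]
  constructor <;> linarith

end IsBoundedGeodesic

end TugOfWar

namespace TugOfWar

/-! ### The intrinsic metric -/

section Intrinsic

variable {d : ℕ} {S : Set (EuclideanSpace ℝ (Fin d))}

theorem intrinsicEDist_le {x y : S} (γ : Path x y) :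
    intrinsicEDist x y ≤ eVariationOn (fun t => (γ t : EuclideanSpace ℝ (Fin d))) univ :=
  iInf_le _ γ

theorem edist_le_intrinsicEDist (x y : S) :
    edist (x : EuclideanSpace ℝ (Fin d)) y ≤ intrinsicEDist x y := by
  refine le_iInf fun γ => ?_
  simpa using eVariationOn.edist_le (fun t => (γ t : EuclideanSpace ℝ (Fin d)))
    (mem_univ (0 : unitInterval)) (mem_univ 1)

theorem intrinsicEDist_comm (x y : S) : intrinsicEDist x y = intrinsicEDist y x := by
  have key (x y : S) : intrinsicEDist x y ≤ intrinsicEDist y x := by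
    refine le_iInf fun γ => (intrinsicEDist_le γ.symm).trans ?_
    exact eVariationOn.comp_le_of_antitoneOn (fun t => (γ t : EuclideanSpace ℝ (Fin d)))
      unitInterval.symm (fun s _ t _ h => unitInterval.symm_le_symm.2 h) (mapsTo_univ _ _)
  exact (key x y).antisymm (key y x)

theorem intrinsicEDist_le_variation_left {x y : S} (γ : Path x y) (τ : unitInterval) :
    intrinsicEDist x (γ τ)
      ≤ eVariationOn (fun t => (γ t : EuclideanSpace ℝ (Fin d))) (Iic τ) := by
  let γ' : Path x (γ τ) :=
    { toFun := fun s => γ (τ * s)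
      continuous_toFun := by fun_prop
      source' := by simp
      target' := by simp }
  refine (intrinsicEDist_le γ').trans ?_
  exact eVariationOn.comp_le_of_monotoneOn (fun t => (γ t : EuclideanSpace ℝ (Fin d)))
    (fun s : unitInterval => τ * s) (fun s _ t _ h => mul_le_mul_right h τ)
    (fun s _ => unitInterval.mul_le_left)

theorem intrinsicEDist_le_variation_right {x y : S} (γ : Path x y) (τ : unitInterval) :
    intrinsicEDist (γ τ) y
      ≤ eVariationOn (fun t => (γ t : EuclideanSpace ℝ (Fin d))) (Ici τ) := by
  let γ' : Path (γ τ) y :=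
    { toFun := fun s => γ (unitInterval.symm (unitInterval.symm τ * unitInterval.symm s))
      continuous_toFun := by fun_prop
      source' := by simp
      target' := by simp }
  refine (intrinsicEDist_le γ').trans ?_
  refine eVariationOn.comp_le_of_monotoneOn (fun t => (γ t : EuclideanSpace ℝ (Fin d)))
    (fun s : unitInterval => unitInterval.symm (unitInterval.symm τ * unitInterval.symm s))
    (fun s _ t _ h => ?_) (fun s _ => ?_)
  · exact unitInterval.symm_le_symm.2 (mul_le_mul_right (unitInterval.symm_le_symm.2 h) _)
  · exact unitInterval.le_symm_comm.1 unitInterval.mul_le_left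

theorem intrinsicEDist_triangle (x y z : S) :
    intrinsicEDist x z ≤ intrinsicEDist x y + intrinsicEDist y z := by
  refine ENNReal.le_iInf_add_iInf fun γ₁ γ₂ => (intrinsicEDist_le (γ₁.trans γ₂)).trans ?_
  let half : unitInterval := ⟨1 / 2, by norm_num, by norm_num⟩
  conv_lhs => rw [← Iic_union_Ici (a := half), eVariationOn.union _ isGreatest_Iic isLeast_Ici]
  refine add_le_add ?_ ?_
  · refine (eVariationOn.eq_of_eqOn (f' := (fun t => (γ₁ t : EuclideanSpace ℝ (Fin d))) ∘
      fun t : unitInterval => projIcc 0 1 zero_le_one (2 * (t : ℝ))) fun t ht => ?_).trans_le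
      (eVariationOn.comp_le_of_monotoneOn _ _ (fun s _ t _ h => monotone_projIcc _ ?_)
        (mapsTo_univ _ _))
    · have ht' : (t : ℝ) ≤ 1 / 2 := ht
      simp only [Path.trans, Path.coe_mk_mk, Function.comp, if_pos ht']
      rfl
    · have : (s : ℝ) ≤ t := h
      linarith
  · refine (eVariationOn.eq_of_eqOn (f' := (fun t => (γ₂ t : EuclideanSpace ℝ (Fin d))) ∘
      fun t : unitInterval => projIcc 0 1 zero_le_one (2 * (t : ℝ) - 1)) fun t ht => ?_).trans_le
      (eVariationOn.comp_le_of_monotoneOn _ _ (fun s _ t _ h => monotone_projIcc _ ?_)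
        (mapsTo_univ _ _))
    · have ht' : (1 / 2 : ℝ) ≤ t := ht
      rcases ht'.eq_or_lt with h | h
      · simp [Path.trans, Function.comp, ← h]
      · simp only [Path.trans, Path.coe_mk_mk, Function.comp, if_neg h.not_ge]
        rfl
    · have : (s : ℝ) ≤ t := h
      linarith

theorem intrinsicEDist_le_of_segment_subset {x y : S}
    (h : segment ℝ (x : EuclideanSpace ℝ (Fin d)) y ⊆ S) :
    intrinsicEDist x y ≤ ENNReal.ofReal (dist (x : EuclideanSpace ℝ (Fin d)) y) := by
  let γ : Path x y :=
    { toFun := fun t => ⟨AffineMap.lineMap (x : EuclideanSpace ℝ (Fin d)) y (t : ℝ), h (by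
        rw [segment_eq_image_lineMap]
        exact mem_image_of_mem _ t.2)⟩
      continuous_toFun := by
        refine Continuous.subtype_mk ?_ _
        exact AffineMap.lineMap_continuous.comp continuous_subtype_val
      source' := by simp
      target' := by simp }
  refine (intrinsicEDist_le γ).trans ?_
  have h1 : LipschitzOnWith (nndist (x : EuclideanSpace ℝ (Fin d)) y)
      (AffineMap.lineMap (k := ℝ) (x : EuclideanSpace ℝ (Fin d)) y) univ :=
    (lipschitzWith_lineMap _ _).lipschitzOnWith
  have h2 := h1.comp_eVariationOn_le (g := fun t : unitInterval => (t : ℝ)) (s := univ)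
    (mapsTo_univ _ _)
  have h3 : eVariationOn (fun t : unitInterval => (t : ℝ)) univ ≤ 1 := by
    have hI : (univ : Set unitInterval) = univ ∩ Icc 0 1 := by
      refine (eq_univ_of_forall fun t => ?_).symm
      exact ⟨mem_univ t, unitInterval.nonneg', unitInterval.le_one'⟩
    rw [hI, ((Subtype.mono_coe (· ∈ unitInterval)).monotoneOn univ).eVariationOn_eq
      (mem_univ 0) (mem_univ 1)]
    simp
  refine h2.trans ((mul_le_mul_right h3 _).trans ?_)
  rw [mul_one, ← edist_dist, edist_nndist]

theorem intrinsicEDist_self (x : S) : intrinsicEDist x x = 0 := by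
  have h := intrinsicEDist_le_of_segment_subset (x := x) (y := x) (by simp)
  simpa using h

/-- In a compact connected set in which points that are close to a given point are close to it for
the intrinsic distance as well, the intrinsic distance is finite and geodesic. -/
theorem exists_isBoundedGeodesic_intrinsicEDist [CompactSpace S] [ConnectedSpace S]
    (hloc : ∀ z : S, ∀ η > 0, ∀ᶠ x in 𝓝 z, intrinsicEDist z x ≤ ENNReal.ofReal η) :
    (∀ x y : S, intrinsicEDist x y ≠ ⊤) ∧
      ∃ R, IsBoundedGeodesic (fun x y : S => (intrinsicEDist x y).toReal) R := by
  have hfin (x y : S) : intrinsicEDist x y ≠ ⊤ := by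
    have hclopen : IsClopen {y : S | intrinsicEDist x y ≠ ⊤} := by
      constructor
      · rw [← isOpen_compl_iff, isOpen_iff_mem_nhds]
        intro y hy
        filter_upwards [hloc y 1 one_pos] with z hz hxz
        refine hy (ne_top_of_le_ne_top ?_ (intrinsicEDist_triangle x z y))
        rw [intrinsicEDist_comm z y]
        exact ENNReal.add_ne_top.2 ⟨hxz, ne_top_of_le_ne_top ENNReal.ofReal_ne_top hz⟩
      · rw [isOpen_iff_mem_nhds]
        intro y hy
        filter_upwards [hloc y 1 one_pos] with z hz
        refine ne_top_of_le_ne_top ?_ (intrinsicEDist_triangle x y z)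
        exact ENNReal.add_ne_top.2 ⟨hy, ne_top_of_le_ne_top ENNReal.ofReal_ne_top hz⟩
    have := hclopen.eq_univ ⟨x, by simp [intrinsicEDist_self]⟩
    exact this.ge (mem_univ y)
  refine ⟨hfin, ?_⟩
  set ρ : S → S → ℝ := fun x y => (intrinsicEDist x y).toReal with hρ
  have hself (x : S) : ρ x x = 0 := by simp [hρ, intrinsicEDist_self]
  have hsymm (x y : S) : ρ x y = ρ y x := by simp only [hρ, intrinsicEDist_comm]
  have htri (x y z : S) : ρ x z ≤ ρ x y + ρ y z := by
    simp only [hρ]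
    rw [← ENNReal.toReal_add (hfin _ _) (hfin _ _)]
    exact ENNReal.toReal_mono (ENNReal.add_ne_top.2 ⟨hfin _ _, hfin _ _⟩)
      (intrinsicEDist_triangle x y z)
  have hcont (x : S) : Continuous (ρ x) := by
    rw [continuous_iff_continuousAt]
    intro y
    rw [ContinuousAt, Metric.tendsto_nhds]
    intro η hη
    filter_upwards [hloc y (η / 2) (half_pos hη)] with z hz
    have h1 : ρ y z ≤ η / 2 := ENNReal.toReal_le_of_le_ofReal (half_pos hη).le hz
    have h2 := htri x y z
    have h3 := htri x z y
    rw [hsymm z y] at h3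
    rw [Real.dist_eq, abs_lt]
    constructor <;> linarith
  have hsplit (x y : S) (s t : ℝ) (hs : 0 ≤ s) (ht : 0 ≤ t) (hxy : ρ x y ≤ s + t) :
      ∃ z, ρ x z ≤ s ∧ ρ z y ≤ t := by
    by_cases hs' : ρ x y ≤ s
    · exact ⟨y, hs', by rwa [hself]⟩
    push Not at hs'
    have hcpt : IsCompact {z | ρ x z ≤ s} := (isClosed_le (hcont x) continuous_const).isCompact
    obtain ⟨z, hz, hmin⟩ := hcpt.exists_isMinOn ⟨x, by simpa [hself] using hs⟩
      (hcont y).continuousOn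
    refine ⟨z, hz, le_of_forall_pos_le_add fun η hη => ?_⟩
    have hlt : intrinsicEDist x y < ENNReal.ofReal (s + t + η) := by
      rw [ENNReal.lt_ofReal_iff_toReal_lt (hfin x y)]
      simp only [hρ] at hxy
      linarith
    obtain ⟨γ, hγ⟩ := iInf_lt_iff.1 hlt
    -- A point of the path at intrinsic distance exactly `s` from its start.
    obtain ⟨τ, hτ⟩ := mem_range_of_exists_le_of_exists_ge ((hcont x).comp γ.continuous)
      ⟨0, by simpa [hself] using hs⟩ ⟨1, by simpa using hs'.le⟩
    have h1 : intrinsicEDist x (γ τ) + intrinsicEDist (γ τ) y ≤ ENNReal.ofReal (s + t + η) := by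
      refine (add_le_add (intrinsicEDist_le_variation_left γ τ)
        (intrinsicEDist_le_variation_right γ τ)).trans (le_trans ?_ hγ.le)
      refine (eVariationOn.add_le_union _ fun a ha b hb => ?_).trans
        (eVariationOn.mono _ (subset_univ _))
      exact le_trans (mem_Iic.1 ha) (mem_Ici.1 hb)
    have h2 := ENNReal.toReal_le_of_le_ofReal (by linarith) h1
    rw [ENNReal.toReal_add (hfin _ _) (hfin _ _)] at h2
    have h3 : ρ y z ≤ ρ y (γ τ) := hmin (show ρ x (γ τ) ≤ s from hτ.le)
    rw [hsymm y, hsymm y] at h3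
    simp only [hρ, Function.comp] at h3 hτ ⊢
    linarith
  obtain ⟨x₀⟩ : Nonempty S := inferInstance
  obtain ⟨z, -, hmax⟩ := isCompact_univ.exists_isMaxOn univ_nonempty (hcont x₀).continuousOn
  refine ⟨ρ x₀ z + ρ x₀ z, hself, hsymm, htri, hsplit, fun x y => (htri x x₀ y).trans ?_⟩
  rw [hsymm x x₀]
  exact add_le_add (hmax (mem_univ x)) (hmax (mem_univ y))

end Intrinsic

end TugOfWar

namespace TugOfWar

/-! ### Inward directions at the points of a domain with `C¹` boundary -/

section Inward

variable {d : ℕ}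

/-- From the points of `S` close to `z`, short steps in the directions close to `w₀` do not leave
`S`. At interior points every direction has this property. -/
def IsInwardAt (S : Set (EuclideanSpace ℝ (Fin d))) (z w₀ : EuclideanSpace ℝ (Fin d)) : Prop :=
  ∃ r > 0, ∀ x ∈ S, dist x z < r → ∀ w, dist w w₀ < r → ∀ s, 0 ≤ s → s ≤ r → x + s • w ∈ S

theorem isInwardAt_of_eventually {S : Set (EuclideanSpace ℝ (Fin d))}
    {z w₀ : EuclideanSpace ℝ (Fin d)}
    (h : ∀ᶠ p : EuclideanSpace ℝ (Fin d) × EuclideanSpace ℝ (Fin d) × ℝ in 𝓝 (z, w₀, 0),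
      p.1 ∈ S → 0 ≤ p.2.2 → p.1 + p.2.2 • p.2.1 ∈ S) : IsInwardAt S z w₀ := by
  obtain ⟨r, hr, h⟩ := Metric.eventually_nhds_iff.1 h
  refine ⟨r / 2, half_pos hr, fun x hx hxz w hw s hs hsr => h (y := (x, w, s)) ?_ hx hs⟩
  rw [Prod.dist_eq, Prod.dist_eq]
  refine max_lt (by simp only; linarith) (max_lt (by simp only; linarith) ?_)
  rw [Real.dist_eq, sub_zero, abs_of_nonneg hs]
  linarith

theorem tendsto_add_smul (z w₀ : EuclideanSpace ℝ (Fin d)) :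
    Tendsto (fun p : EuclideanSpace ℝ (Fin d) × EuclideanSpace ℝ (Fin d) × ℝ =>
      p.1 + p.2.2 • p.2.1) (𝓝 (z, w₀, 0)) (𝓝 z) := by
  have : Continuous fun p : EuclideanSpace ℝ (Fin d) × EuclideanSpace ℝ (Fin d) × ℝ =>
      p.1 + p.2.2 • p.2.1 := by fun_prop
  simpa using this.tendsto (z, w₀, 0)

theorem isInwardAt_of_mem {Ω : Set (EuclideanSpace ℝ (Fin d))} (hΩ : IsOpen Ω)
    {z : EuclideanSpace ℝ (Fin d)} (hz : z ∈ Ω) (w₀ : EuclideanSpace ℝ (Fin d)) :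
    IsInwardAt (closure Ω) z w₀ := by
  apply isInwardAt_of_eventually
  filter_upwards [(tendsto_add_smul z w₀).eventually (hΩ.mem_nhds hz)] with p hp _ _
  exact subset_closure hp

variable {Ω : Set (EuclideanSpace ℝ (Fin d))} {z : EuclideanSpace ℝ (Fin d)}

theorem C1Chart.normal_ne_zero (c : C1Chart Ω z) : c.normal ≠ 0 := by
  rw [C1Chart.normal]
  refine smul_ne_zero (inv_ne_zero (Real.sqrt_ne_zero'.2 (by positivity))) ?_
  rw [Ne, LinearIsometryEquiv.map_eq_zero_iff]
  intro h
  have := congrArg (fun p : WithLp 2 (EuclideanSpace ℝ (Fin (d - 1)) × ℝ) => p.snd) h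
  simp at this

theorem C1Chart.fderiv_lt_of_inner_normal_neg (c : C1Chart Ω z)
    {w : WithLp 2 (EuclideanSpace ℝ (Fin (d - 1)) × ℝ)}
    (hw : inner ℝ (c.T.linearIsometryEquiv w) c.normal < 0) :
    fderiv ℝ c.φ 0 w.fst < w.snd := by
  rw [C1Chart.normal, inner_smul_right, LinearIsometryEquiv.inner_map_map,
    WithLp.prod_inner_apply] at hw
  have h1 : 0 < (Real.sqrt (1 + ‖gradient c.φ 0‖ ^ 2))⁻¹ := by positivity
  have h2 := neg_of_mul_neg_right hw h1.le
  simp only [WithLp.ofLp_fst, WithLp.ofLp_snd, inner_gradient_right] at h2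
  simp at h2
  linarith

theorem C1Chart.mem_closure_of_le (c : C1Chart Ω z) {y : EuclideanSpace ℝ (Fin (d - 1))} {t : ℝ}
    (hy : y ∈ c.U) (ht : c.φ y ≤ t) (hV : c.T (WithLp.toLp 2 (y, t)) ∈ c.V) :
    c.T (WithLp.toLp 2 (y, t)) ∈ closure Ω := by
  rcases ht.eq_or_lt with rfl | ht
  · have : c.T (WithLp.toLp 2 (y, c.φ y)) ∈ c.V ∩ frontier Ω :=
      c.graph_eq ▸ mem_image_of_mem (fun y => c.T (WithLp.toLp 2 (y, c.φ y))) hy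
    exact frontier_subset_closure this.2
  · have : c.T (WithLp.toLp 2 (y, t)) ∈ c.V ∩ Ω := c.above_eq ▸ ⟨hV, y, hy, t, ht, rfl⟩
    exact subset_closure this.2

theorem C1Chart.exists_of_mem_closure (c : C1Chart Ω z) (hΩ : IsOpen Ω)
    {x : EuclideanSpace ℝ (Fin d)} (hx : x ∈ closure Ω) (hV : x ∈ c.V) :
    ∃ y ∈ c.U, ∃ t, c.φ y ≤ t ∧ x = c.T (WithLp.toLp 2 (y, t)) := by
  by_cases hxΩ : x ∈ Ω
  · have : x ∈ c.V ∩ {p | ∃ y ∈ c.U, ∃ t, c.φ y < t ∧ p = c.T (WithLp.toLp 2 (y, t))} :=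
      c.above_eq ▸ ⟨hV, hxΩ⟩
    obtain ⟨-, y, hy, t, ht, h⟩ := this
    exact ⟨y, hy, t, ht.le, h⟩
  · have : x ∈ (fun y => c.T (WithLp.toLp 2 (y, c.φ y))) '' c.U :=
      c.graph_eq ▸ ⟨hV, by rw [hΩ.frontier_eq]; exact ⟨hx, hxΩ⟩⟩
    obtain ⟨y, hy, h⟩ := this
    exact ⟨y, hy, _, le_rfl, h.symm⟩

/-- The directions that make an acute angle with the inward normal are inward: in the chart the
increment of the `C¹` function along them is smaller than that of the height. -/
theorem C1Chart.isInwardAt (c : C1Chart Ω z) (hΩ : IsOpen Ω) {w₀ : EuclideanSpace ℝ (Fin d)}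
    (hw₀ : inner ℝ w₀ c.normal < 0) : IsInwardAt (closure Ω) z w₀ := by
  set L := c.T.linearIsometryEquiv with hL
  set A := fderiv ℝ c.φ 0 with hA
  have hφ : HasStrictFDerivAt c.φ A 0 :=
    (c.contDiffOn_φ.contDiffAt (c.isOpen_U.mem_nhds c.zero_mem_U)).hasStrictFDerivAt (by simp)
  have hAw : A (L.symm w₀).fst < (L.symm w₀).snd :=
    c.fderiv_lt_of_inner_normal_neg (by rwa [← hL, LinearIsometryEquiv.apply_symm_apply])
  have hfst : Continuous fun q : WithLp 2 (EuclideanSpace ℝ (Fin (d - 1)) × ℝ) => q.fst :=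
    WithLp.continuous_fst 2 _ _
  have hsnd : Continuous fun q : WithLp 2 (EuclideanSpace ℝ (Fin (d - 1)) × ℝ) => q.snd :=
    WithLp.continuous_snd 2 _ _
  obtain ⟨η, hη, hAη⟩ : ∃ η > 0, A (L.symm w₀).fst + η * ‖(L.symm w₀).fst‖ < (L.symm w₀).snd := by
    have hcont : Continuous fun η : ℝ => A (L.symm w₀).fst + η * ‖(L.symm w₀).fst‖ := by fun_prop
    have hev := (hcont.tendsto 0).eventually (gt_mem_nhds (by simpa using hAw))
    obtain ⟨η, h1, h2⟩ := ((hev.filter_mono nhdsWithin_le_nhds).and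
      (self_mem_nhdsWithin (s := Ioi 0))).exists
    exact ⟨η, h2, h1⟩
  have hz : c.T.symm z = WithLp.toLp 2 (0, c.φ 0) := by
    have := c.T.symm_apply_apply (WithLp.toLp 2 (0, c.φ 0))
    rwa [c.map_base] at this
  -- The horizontal coordinates of a point and of the point after a step.
  let Y := fun p : EuclideanSpace ℝ (Fin d) × EuclideanSpace ℝ (Fin d) × ℝ => (c.T.symm p.1).fst
  let Y' := fun p : EuclideanSpace ℝ (Fin d) × EuclideanSpace ℝ (Fin d) × ℝ =>
    (c.T.symm p.1).fst + p.2.2 • (L.symm p.2.1).fst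
  have hYc : Continuous Y := hfst.comp (c.T.symm.continuous.comp continuous_fst)
  have hY'c : Continuous Y' := hYc.add ((continuous_snd.comp continuous_snd).smul
    (hfst.comp (L.symm.continuous.comp (continuous_fst.comp continuous_snd))))
  have hY0 : Y (z, w₀, 0) = 0 := by simp [Y, hz]
  have hY'0 : Y' (z, w₀, 0) = 0 := by simp [Y', hz]
  have hY : Tendsto Y (𝓝 (z, w₀, 0)) (𝓝 0) := by simpa only [hY0] using hYc.tendsto (z, w₀, 0)
  have hY' : Tendsto Y' (𝓝 (z, w₀, 0)) (𝓝 0) := by simpa only [hY'0] using hY'c.tendsto (z, w₀, 0)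
  have hlin : ∀ᶠ p in 𝓝 (z, w₀, (0 : ℝ)),
      ‖c.φ (Y' p) - c.φ (Y p) - A (Y' p - Y p)‖ ≤ η * ‖Y' p - Y p‖ :=
    (hY'.prodMk_nhds hY).eventually (hφ.isLittleO.def hη)
  have hcone : ∀ᶠ p in 𝓝 (z, w₀, (0 : ℝ)),
      A (L.symm p.2.1).fst + η * ‖(L.symm p.2.1).fst‖ < (L.symm p.2.1).snd := by
    have hc : Continuous fun p : EuclideanSpace ℝ (Fin d) × EuclideanSpace ℝ (Fin d) × ℝ =>
      L.symm p.2.1 := L.symm.continuous.comp (continuous_fst.comp continuous_snd)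
    have h1 := hfst.comp hc
    exact ((A.continuous.comp h1).add (continuous_const.mul h1.norm)).continuousAt.eventually_lt
      (hsnd.comp hc).continuousAt hAη
  apply isInwardAt_of_eventually
  filter_upwards [hlin, hcone, continuous_fst.continuousAt (c.isOpen_V.mem_nhds c.mem_V),
    (tendsto_add_smul z w₀).eventually (c.isOpen_V.mem_nhds c.mem_V),
    hY'.eventually (c.isOpen_U.mem_nhds c.zero_mem_U)]
    with p h1 h2 (h3 : p.1 ∈ c.V) h4 h5 hp hs
  obtain ⟨y, hy, t, ht, hx⟩ := c.exists_of_mem_closure hΩ hp h3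
  have hsym : c.T.symm p.1 = WithLp.toLp 2 (y, t) := by
    rw [hx, AffineIsometryEquiv.symm_apply_apply]
  have hYp : Y p = y := by simp [Y, hsym]
  have hY'p : Y' p = y + p.2.2 • (L.symm p.2.1).fst := by simp [Y', hsym]
  have heq : p.1 + p.2.2 • p.2.1
      = c.T (WithLp.toLp 2 (Y' p, t + p.2.2 • (L.symm p.2.1).snd)) := by
    have e1 : (WithLp.toLp 2 (Y' p, t + p.2.2 • (L.symm p.2.1).snd) :
        WithLp 2 (EuclideanSpace ℝ (Fin (d - 1)) × ℝ))
        = (p.2.2 • L.symm p.2.1) +ᵥ WithLp.toLp 2 (y, t) := by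
      rw [hY'p, vadd_eq_add, add_comm y, add_comm t]
      rfl
    rw [e1, AffineIsometryEquiv.map_vadd, ← hx, ← hL, map_smul,
      LinearIsometryEquiv.apply_symm_apply, vadd_eq_add, add_comm]
  rw [heq] at h4 ⊢
  refine c.mem_closure_of_le h5 ?_ h4
  rw [hYp, hY'p, add_sub_cancel_left, Real.norm_eq_abs, map_smul, norm_smul, Real.norm_eq_abs,
    abs_of_nonneg hs, smul_eq_mul] at h1
  rw [hY'p, smul_eq_mul]
  nlinarith [(abs_le.1 h1).2]

theorem exists_isInwardAt (hΩ : IsOpen Ω) (hbdry : HasC1Boundary Ω) (hz : z ∈ closure Ω) :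
    ∃ w₀, IsInwardAt (closure Ω) z w₀ := by
  by_cases hzΩ : z ∈ Ω
  · exact ⟨0, isInwardAt_of_mem hΩ hzΩ 0⟩
  · obtain ⟨c⟩ := hbdry z (by rw [hΩ.frontier_eq]; exact ⟨hz, hzΩ⟩)
    refine ⟨-c.normal, c.isInwardAt hΩ ?_⟩
    rw [inner_neg_left, neg_lt_zero]
    exact real_inner_self_pos.2 c.normal_ne_zero

theorem isInwardAt_of_inner_outwardNormal_neg (hΩ : IsOpen Ω) (hbdry : HasC1Boundary Ω)
    (hz : z ∈ frontier Ω) {w₀ : EuclideanSpace ℝ (Fin d)}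
    (hw₀ : inner ℝ w₀ (outwardNormal Ω z) < 0) : IsInwardAt (closure Ω) z w₀ := by
  rw [outwardNormal, dif_pos (hbdry z hz)] at hw₀
  exact C1Chart.isInwardAt _ hΩ hw₀

/-- A step in an inward direction is a path in `S`. -/
theorem IsInwardAt.exists_intrinsicEDist_le {S : Set (EuclideanSpace ℝ (Fin d))}
    {w₀ : EuclideanSpace ℝ (Fin d)} (h : IsInwardAt S z w₀) :
    ∃ r > 0, ∀ x : S, dist (x : EuclideanSpace ℝ (Fin d)) z < r → ∀ w, dist w w₀ < r →
      ∀ s, 0 ≤ s → s ≤ r → ∃ y : S, (y : EuclideanSpace ℝ (Fin d)) = x + s • w ∧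
        intrinsicEDist x y ≤ ENNReal.ofReal (s * ‖w‖) := by
  obtain ⟨r, hr, h⟩ := h
  refine ⟨r, hr, fun x hx w hw s hs hsr => ⟨⟨_, h x x.2 hx w hw s hs hsr⟩, rfl, ?_⟩⟩
  refine (intrinsicEDist_le_of_segment_subset ?_).trans_eq ?_
  · rw [segment_eq_image']
    rintro _ ⟨θ, hθ, rfl⟩
    simp only [add_sub_cancel_left, smul_smul]
    exact h x x.2 hx w hw _ (mul_nonneg hθ.1 hs) ((mul_le_of_le_one_left hs hθ.2).trans hsr)
  · simp [norm_smul, abs_of_nonneg hs]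

/-- Two nearby points of `S` can be joined by a short path through a point reached from them by
steps in inward directions. -/
theorem IsInwardAt.eventually_intrinsicEDist_le {S : Set (EuclideanSpace ℝ (Fin d))} {z : S}
    {w₀ : EuclideanSpace ℝ (Fin d)} (h : IsInwardAt S z w₀) {η : ℝ} (hη : 0 < η) :
    ∀ᶠ x in 𝓝 z, intrinsicEDist z x ≤ ENNReal.ofReal η := by
  obtain ⟨r, hr, h⟩ := h.exists_intrinsicEDist_le
  set s := min r (η / (2 * ‖w₀‖ + 1)) with hs
  have hs0 : 0 < s := lt_min hr (by positivity)
  have hsη : s * (2 * ‖w₀‖ + 1) ≤ η := by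
    rw [← le_div_iff₀ (by positivity)]
    exact min_le_right _ _
  obtain ⟨y, hy, hzy⟩ := h z (by simpa using hr) w₀ (by simpa using hr) s hs0.le (min_le_left _ _)
  filter_upwards [Metric.ball_mem_nhds z (show 0 < min r (min (s * r) s) by positivity)] with x hx
  rw [Metric.mem_ball, lt_min_iff, lt_min_iff, Subtype.dist_eq] at hx
  obtain ⟨y', hy', hxy⟩ := h x hx.1 (w₀ + s⁻¹ • ((z : EuclideanSpace ℝ (Fin d)) - x)) (by
      rw [dist_eq_norm, add_sub_cancel_left, norm_smul, norm_inv, Real.norm_eq_abs,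
        abs_of_pos hs0, inv_mul_lt_iff₀ hs0, ← dist_eq_norm, dist_comm]
      exact hx.2.1) s hs0.le (min_le_left _ _)
  have hyy : y' = y := by
    apply Subtype.ext
    rw [hy, hy', smul_add, smul_inv_smul₀ hs0.ne']
    abel
  rw [hyy] at hxy
  refine (intrinsicEDist_triangle z y x).trans ?_
  rw [intrinsicEDist_comm y x]
  refine (add_le_add hzy hxy).trans ?_
  rw [← ENNReal.ofReal_add (by positivity) (by positivity)]
  refine ENNReal.ofReal_le_ofReal (le_trans ?_ hsη)
  have h1 : s * ‖w₀ + s⁻¹ • ((z : EuclideanSpace ℝ (Fin d)) - x)‖ ≤ s * ‖w₀‖ + s := by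
    rw [← abs_of_pos hs0, ← Real.norm_eq_abs, ← norm_smul, smul_add, Real.norm_eq_abs,
      abs_of_pos hs0, smul_inv_smul₀ hs0.ne']
    refine (norm_add_le _ _).trans ?_
    rw [norm_smul, Real.norm_eq_abs, abs_of_pos hs0, ← dist_eq_norm, dist_comm]
    linarith [hx.2.2]
  linarith

end Inward

end TugOfWar

namespace TugOfWar

/-! ### Discrete infinity Laplacians of smooth functions -/

section Smooth

variable {d : ℕ}

/-- Second order Taylor estimate, uniform with respect to the base point `x`, with the second
derivative frozen at `x₀`. -/
theorem exists_abs_taylor_le {φ : EuclideanSpace ℝ (Fin d) → ℝ} {x₀ : EuclideanSpace ℝ (Fin d)}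
    (hφ : ContDiffAt ℝ 2 φ x₀) {η : ℝ} (hη : 0 < η) :
    ∃ r > 0, ∀ x, dist x x₀ < r → ∀ w, ‖w‖ < r →
      |φ (x + w) - φ x - fderiv ℝ φ x w - hessianForm φ x₀ w / 2| ≤ η * ‖w‖ ^ 2 := by
  set Q := fderiv ℝ (fderiv ℝ φ) x₀ with hQ
  have hF : HasStrictFDerivAt (fderiv ℝ φ) Q x₀ :=
    (hφ.fderiv_right (m := 1) (by norm_num)).hasStrictFDerivAt (by simp)
  have h1 : ∀ᶠ p : EuclideanSpace ℝ (Fin d) × EuclideanSpace ℝ (Fin d) in 𝓝 (x₀, x₀),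
      ‖fderiv ℝ φ p.1 - fderiv ℝ φ p.2 - Q (p.1 - p.2)‖ ≤ η * ‖p.1 - p.2‖ := hF.isLittleO.def hη
  have h2 : ∀ᶠ x in 𝓝 x₀, DifferentiableAt ℝ φ x :=
    (hφ.eventually (by simp)).mono fun x hx => hx.differentiableAt (by simp)
  obtain ⟨R, hR, h3⟩ := Metric.eventually_nhds_iff.1 h1
  obtain ⟨R', hR', h4⟩ := Metric.eventually_nhds_iff.1 h2
  refine ⟨min R R' / 2, by positivity, fun x hx w hw => ?_⟩
  have hnear {t : ℝ} (ht : t ∈ Icc (0 : ℝ) 1) : dist (x + t • w) x₀ < min R R' := by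
    have h5 : dist (x + t • w) x ≤ ‖w‖ := by
      rw [dist_eq_norm, add_sub_cancel_left, norm_smul, Real.norm_eq_abs, abs_of_nonneg ht.1]
      exact mul_le_of_le_one_left (norm_nonneg w) ht.2
    linarith [dist_triangle (x + t • w) x x₀]
  have hderiv {t : ℝ} (ht : t ∈ Icc (0 : ℝ) 1) :
      HasDerivAt (fun t : ℝ => φ (x + t • w) - t * fderiv ℝ φ x w - t ^ 2 * (Q w w / 2))
        (fderiv ℝ φ (x + t • w) w - fderiv ℝ φ x w - t * Q w w) t := by
    have h5 : HasDerivAt (fun t : ℝ => x + t • w) w t := by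
      simpa using ((hasDerivAt_id t).smul_const w).const_add x
    have h6 := (h4 ((hnear ht).trans_le (min_le_right _ _))).hasFDerivAt.comp_hasDerivAt t h5
    have h7 := (h6.sub ((hasDerivAt_id t).mul_const (fderiv ℝ φ x w))).sub
      (((hasDerivAt_id t).pow 2).mul_const (Q w w / 2))
    refine HasDerivAt.congr_deriv h7 ?_
    simp only [id, Nat.cast_ofNat]
    ring
  have h5 := norm_image_sub_le_of_norm_deriv_le_segment_01' (C := η * ‖w‖ ^ 2)
    (fun t ht => (hderiv ht).hasDerivWithinAt) (fun t ht => by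
      have ht' : t ∈ Icc (0 : ℝ) 1 := ⟨ht.1, ht.2.le⟩
      have h6 := h3 (y := (x + t • w, x)) (by
        rw [Prod.dist_eq]
        refine max_lt ((hnear ht').trans_le (min_le_left _ _)) ?_
        simp only
        linarith [min_le_left R R', half_lt_self (lt_min hR hR')])
      simp only [add_sub_cancel_left] at h6
      have h7 : fderiv ℝ φ (x + t • w) w - fderiv ℝ φ x w - t * Q w w
          = (fderiv ℝ φ (x + t • w) - fderiv ℝ φ x - Q (t • w)) w := by
        simp
      rw [h7]
      refine (ContinuousLinearMap.le_of_opNorm_le _ h6 w).trans ?_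
      rw [norm_smul, Real.norm_eq_abs, abs_of_nonneg ht.1, pow_two]
      have := mul_nonneg (norm_nonneg w) (norm_nonneg w)
      nlinarith [mul_nonneg hη.le this, ht.2])
  convert h5 using 1
  rw [Real.norm_eq_abs]
  congr 1
  simp [hessianForm, hQ]
  ring

theorem bddAbove_hessianForm (φ : EuclideanSpace ℝ (Fin d) → ℝ) (x : EuclideanSpace ℝ (Fin d)) :
    BddAbove (hessianForm φ x '' {v | ‖v‖ = 1}) := by
  refine ⟨‖fderiv ℝ (fderiv ℝ φ) x‖, ?_⟩
  rintro _ ⟨v, hv : ‖v‖ = 1, rfl⟩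
  have := (fderiv ℝ (fderiv ℝ φ) x).le_opNorm₂ v v
  rw [hv, mul_one, mul_one] at this
  exact (le_abs_self _).trans this

theorem hessianForm_le_infLaplacianPlus {φ : EuclideanSpace ℝ (Fin d) → ℝ}
    {x : EuclideanSpace ℝ (Fin d)} (hφ : gradient φ x = 0) (w : EuclideanSpace ℝ (Fin d)) :
    hessianForm φ x w ≤ infLaplacianPlus φ x * ‖w‖ ^ 2 := by
  rw [infLaplacianPlus, if_pos hφ]
  rcases eq_or_ne w 0 with rfl | hw
  · simp [hessianForm]
  · have hw' : ‖w‖ ≠ 0 := norm_ne_zero_iff.2 hw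
    have h1 : hessianForm φ x (‖w‖⁻¹ • w) ≤ sSup (hessianForm φ x '' {v | ‖v‖ = 1}) :=
      le_csSup (bddAbove_hessianForm φ x) (mem_image_of_mem _ (by
        simp [norm_smul, hw']))
    have h2 : hessianForm φ x w = hessianForm φ x (‖w‖⁻¹ • w) * ‖w‖ ^ 2 := by
      simp only [hessianForm, map_smul, smul_apply, smul_eq_mul]
      field_simp
    rw [h2]
    exact mul_le_mul_of_nonneg_right h1 (by positivity)

variable {S : Set (EuclideanSpace ℝ (Fin d))}

theorem mem_intrinsicBall_self (x : S) (ε : ℝ) : x ∈ intrinsicBall x ε := by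
  simp [intrinsicBall, intrinsicEDist_self]

theorem dist_le_of_mem_intrinsicBall {x y : S} {ε : ℝ} (hε : 0 ≤ ε) (h : y ∈ intrinsicBall x ε) :
    dist (y : EuclideanSpace ℝ (Fin d)) x ≤ ε := by
  rw [dist_comm, ← ENNReal.ofReal_le_ofReal_iff hε, ← edist_dist]
  exact (edist_le_intrinsicEDist x y).trans h

/-- Asymptotic upper bound `Λ` for the discrete infinity Laplacian of `φ` near `z`. The minimum over
the intrinsic ball is replaced by the value at a suitable point. -/
def HasDiscreteBound (φ : EuclideanSpace ℝ (Fin d) → ℝ) (z : S) (Λ : ℝ) : Prop :=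
  ∀ η > 0, ∀ᶠ p : S × ℝ in 𝓝 z ×ˢ 𝓝[>] 0, ∃ y' ∈ intrinsicBall p.1 p.2,
    ∀ y ∈ intrinsicBall p.1 p.2, φ y + φ y' - 2 * φ p.1 ≤ p.2 ^ 2 * (Λ + η)

/-- The one-step estimate at a point with gradient `g • p`, where `p` is a unit vector: among the
steps of length at most `ε`, the step `ε • p` is optimal up to an error of order `ε ^ 3`. -/
theorem step_estimate {p w : EuclideanSpace ℝ (Fin d)}
    (Q : EuclideanSpace ℝ (Fin d) →L[ℝ] EuclideanSpace ℝ (Fin d) →L[ℝ] ℝ) {g ε η : ℝ}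
    (hg : 0 < g) (hε : 0 < ε) (hp : ‖p‖ = 1) (hw : ‖w‖ ≤ ε) (hη : ‖Q‖ ^ 2 * ε ≤ 2 * g * η) :
    g * inner ℝ p w - g * ε + Q w w / 2 + ε ^ 2 * Q p p / 2 ≤ ε ^ 2 * (Q p p + η) := by
  set s := ‖w - ε • p‖ with hs
  have h1 : s ^ 2 ≤ 2 * ε ^ 2 - 2 * (ε * inner ℝ p w) := by
    rw [hs, norm_sub_sq_real, inner_smul_right, norm_smul, hp, Real.norm_eq_abs, mul_one, sq_abs,
      real_inner_comm]
    have : ‖w‖ ^ 2 ≤ ε ^ 2 := pow_le_pow_left₀ (norm_nonneg w) hw 2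
    linarith
  have h2 : Q w w - ε ^ 2 * Q p p ≤ 2 * ‖Q‖ * ε * s := by
    have e1 : Q w w - ε ^ 2 * Q p p = Q (w - ε • p) w + Q (ε • p) (w - ε • p) := by
      simp only [map_sub, map_smul, sub_apply, smul_apply,
        smul_eq_mul]
      ring
    have h3 := (le_abs_self _).trans (Q.le_opNorm₂ (w - ε • p) w)
    have h4 := (le_abs_self _).trans (Q.le_opNorm₂ (ε • p) (w - ε • p))
    have h5 : ‖Q‖ * ‖w - ε • p‖ * ‖w‖ ≤ ‖Q‖ * s * ε := by gcongr
    rw [norm_smul, hp, Real.norm_eq_abs, abs_of_pos hε, mul_one] at h4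
    rw [e1]
    linarith
  have h3 : g * inner ℝ p w - g * ε + ‖Q‖ * ε * s ≤ ε ^ 2 * η := by
    refine le_of_mul_le_mul_left (a := 2 * g * ε) ?_ (by positivity)
    have h4 : ‖Q‖ ^ 2 * ε * ε ^ 3 ≤ 2 * g * η * ε ^ 3 := by gcongr
    have h5 := mul_le_mul_of_nonneg_left h1 (sq_nonneg g)
    nlinarith [sq_nonneg (g * s - ‖Q‖ * ε ^ 2)]
  linarith

/-- Where the gradient does not vanish, the opponent of a step towards larger values of `φ` answers
with the step of length `ε` against the gradient. This is possible if the latter is inward. -/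
theorem hasDiscreteBound_of_gradient_ne_zero {φ : EuclideanSpace ℝ (Fin d) → ℝ} {z : S}
    (hφ : ContDiffAt ℝ 2 φ z) (hgrad : gradient φ z ≠ 0)
    (hin : IsInwardAt S z (-(‖gradient φ z‖⁻¹ • gradient φ z))) :
    HasDiscreteBound φ z (infLaplacianPlus φ z) := by
  intro η hη
  set Q := fderiv ℝ (fderiv ℝ φ) z with hQ
  set P : EuclideanSpace ℝ (Fin d) → EuclideanSpace ℝ (Fin d) :=
    fun x => ‖gradient φ x‖⁻¹ • gradient φ x with hP
  obtain ⟨r, hr, hT⟩ := exists_abs_taylor_le hφ (show 0 < η / 4 by positivity)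
  obtain ⟨r', hr', hI⟩ := hin.exists_intrinsicEDist_le
  have hG : ContinuousAt (gradient φ) z := by
    have : ContinuousAt (fderiv ℝ φ) z :=
      (hφ.fderiv_right (m := 1) (by norm_num)).continuousAt
    exact (InnerProductSpace.toDual ℝ _).symm.continuous.continuousAt.comp this
  have hPc : ContinuousAt P z := (hG.norm.inv₀ (norm_ne_zero_iff.2 hgrad)).smul hG
  have hΛ : infLaplacianPlus φ z = Q (P z) (P z) := by
    rw [infLaplacianPlus, if_neg hgrad]
    simp only [hP, hessianForm, map_smul, smul_apply, smul_eq_mul, hQ]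
    ring
  have hQc : ContinuousAt (fun x => Q (P x) (P x)) z :=
    (Q.continuous.continuousAt.comp hPc).clm_apply hPc
  have hval : Tendsto (fun x : S => (x : EuclideanSpace ℝ (Fin d))) (𝓝 z)
      (𝓝 (z : EuclideanSpace ℝ (Fin d))) := continuous_subtype_val.continuousAt
  have hΛη : Q (P z) (P z) < infLaplacianPlus φ z + η / 4 := by
    rw [← hΛ]
    linarith
  have hg0 : 0 < ‖gradient φ z‖ := norm_pos_iff.2 hgrad
  have hx : ∀ᶠ x : S in 𝓝 z, dist (x : EuclideanSpace ℝ (Fin d)) z < min r r' ∧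
      ‖gradient φ z‖ / 2 < ‖gradient φ x‖ ∧ Q (P x) (P x) < infLaplacianPlus φ z + η / 4 ∧
      dist (P x) (P z) < r' := by
    refine (hval.eventually (Metric.ball_mem_nhds _ (lt_min hr hr'))).and
      ((hval.eventually (hG.norm.eventually_const_lt (half_lt_self hg0))).and
      ((hval.eventually (hQc.eventually_lt_const hΛη)).and
      (hval.eventually (hPc.eventually (Metric.ball_mem_nhds _ hr')))))
  have hε : ∀ᶠ ε : ℝ in 𝓝[>] 0, 0 < ε ∧ ε < min r r' ∧
      ‖Q‖ ^ 2 * ε < ‖gradient φ z‖ * (η / 4) := by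
    refine Eventually.and self_mem_nhdsWithin (Eventually.and ?_ ?_)
    · exact mem_of_superset (Ioo_mem_nhdsGT (lt_min hr hr')) fun _ h => h.2
    · have : Continuous fun ε : ℝ => ‖Q‖ ^ 2 * ε := by fun_prop
      refine ((this.tendsto 0).eventually (gt_mem_nhds ?_)).filter_mono nhdsWithin_le_nhds
      rw [mul_zero]
      positivity
  filter_upwards [hx.prod_inl _, hε.prod_inr _]
  rintro ⟨x, ε⟩ ⟨hx1, hx2, hx3, hx4⟩ ⟨hε0, hε1, hε2⟩
  simp only at hx1 hx2 hx3 hx4 hε0 hε1 hε2 ⊢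
  rw [lt_min_iff] at hx1 hε1
  have hgx : 0 < ‖gradient φ x‖ := by linarith
  have hPx : ‖P x‖ = 1 := by
    simp only [hP]
    rw [norm_smul, norm_inv, norm_norm, inv_mul_cancel₀ hgx.ne']
  have hGP : gradient φ x = ‖gradient φ x‖ • P x := by
    simp only [hP]
    rw [smul_inv_smul₀ hgx.ne']
  have hfd (w : EuclideanSpace ℝ (Fin d)) :
      fderiv ℝ φ x w = ‖gradient φ x‖ * inner ℝ (P x) w := by
    rw [← inner_gradient_left, ← real_inner_smul_left, ← hGP]
  obtain ⟨y', hy', hxy'⟩ := hI x hx1.2 (-P x) (by rwa [dist_neg_neg]) ε hε0.le hε1.2.le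
  rw [norm_neg, hPx, mul_one] at hxy'
  refine ⟨y', hxy', fun y hy => ?_⟩
  have hyx := dist_le_of_mem_intrinsicBall hε0.le hy
  rw [dist_eq_norm] at hyx
  have h1 := hT x hx1.1 ((y : EuclideanSpace ℝ (Fin d)) - x) (hyx.trans_lt hε1.1)
  have h2 := hT x hx1.1 (ε • -P x) (by
    rw [norm_smul, norm_neg, hPx, mul_one, Real.norm_eq_abs, abs_of_pos hε0]
    exact hε1.1)
  rw [← hy', hfd, norm_smul, norm_neg, hPx, mul_one, Real.norm_eq_abs, sq_abs,
    inner_smul_right, inner_neg_right, real_inner_self_eq_norm_sq, hPx] at h2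
  rw [add_sub_cancel, hfd] at h1
  have h3 := step_estimate Q (η := η / 4) hgx hε0 hPx hyx (by nlinarith)
  have h4 : hessianForm φ z (ε • -P x) = ε ^ 2 * Q (P x) (P x) := by
    simp only [hessianForm, map_smul, map_neg, smul_apply,
      neg_apply, smul_eq_mul, ← hQ]
    ring
  have h5 : hessianForm φ z (y - x) = Q (y - x) (y - x) := rfl
  rw [h4] at h2
  rw [h5] at h1
  have h6 : η / 4 * ‖(y : EuclideanSpace ℝ (Fin d)) - x‖ ^ 2 ≤ η / 4 * ε ^ 2 := by gcongr
  have h7 : ε ^ 2 * Q (P x) (P x) ≤ ε ^ 2 * (infLaplacianPlus φ z + η / 4) := by gcongr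
  linarith [(abs_le.1 h1).2, (abs_le.1 h2).2]

theorem exists_mem_intrinsicBall_of_ball_subset {z : EuclideanSpace ℝ (Fin d)} {r : ℝ}
    (hball : Metric.ball z r ⊆ S) {x : S} {w : EuclideanSpace ℝ (Fin d)} {ε : ℝ}
    (hx : dist (x : EuclideanSpace ℝ (Fin d)) z + ‖w‖ < r) (hw : ‖w‖ ≤ ε) :
    ∃ y : S, (y : EuclideanSpace ℝ (Fin d)) = x + w ∧ y ∈ intrinsicBall x ε := by
  have hd : dist (x : EuclideanSpace ℝ (Fin d)) (x + w) = ‖w‖ := by simp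
  have hxr : (x : EuclideanSpace ℝ (Fin d)) ∈ Metric.ball z r :=
    lt_of_le_of_lt (le_add_of_nonneg_right (norm_nonneg w)) hx
  have hmem : (x : EuclideanSpace ℝ (Fin d)) + w ∈ Metric.ball z r := by
    rw [Metric.mem_ball]
    have := dist_triangle ((x : EuclideanSpace ℝ (Fin d)) + w) x z
    rw [dist_comm _ (x : EuclideanSpace ℝ (Fin d)), hd] at this
    linarith
  have hseg : segment ℝ (x : EuclideanSpace ℝ (Fin d)) (x + w) ⊆ S :=
    ((convex_ball z r).segment_subset hxr hmem).trans hball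
  refine ⟨⟨_, hball hmem⟩, rfl, ?_⟩
  have h := intrinsicEDist_le_of_segment_subset (x := x) (y := ⟨_, hball hmem⟩) hseg
  rw [hd] at h
  exact h.trans (ENNReal.ofReal_le_ofReal hw)

/-- For a concave parabola the point `z` must differ from its vertex: at the vertex the discrete
infinity Laplacian is only half of the second derivative. -/
theorem hasDiscreteBound_quadratic [Nontrivial (EuclideanSpace ℝ (Fin d))]
    {z : S} (hz : S ∈ 𝓝 (z : EuclideanSpace ℝ (Fin d))) {x₁ : EuclideanSpace ℝ (Fin d)} {μ : ℝ}
    (h : 0 ≤ μ ∨ (z : EuclideanSpace ℝ (Fin d)) ≠ x₁) :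
    HasDiscreteBound (fun x => μ / 2 * ‖x - x₁‖ ^ 2) z μ := by
  intro η hη
  obtain ⟨r, hr, hball⟩ := Metric.mem_nhds_iff.1 hz
  have hlim : Tendsto (fun p : S × ℝ => ‖(p.1 : EuclideanSpace ℝ (Fin d)) - x₁‖)
      (𝓝 z ×ˢ 𝓝[>] 0) (𝓝 ‖(z : EuclideanSpace ℝ (Fin d)) - x₁‖) := by
    have : Continuous fun x : S => ‖(x : EuclideanSpace ℝ (Fin d)) - x₁‖ := by fun_prop
    exact (this.tendsto z).comp tendsto_fst
  have hlim' : Tendsto (fun p : S × ℝ => p.2) (𝓝 z ×ˢ 𝓝[>] 0) (𝓝 0) :=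
    tendsto_snd.mono_right nhdsWithin_le_nhds
  have hfar : ∀ᶠ p : S × ℝ in 𝓝 z ×ˢ 𝓝[>] 0,
      0 ≤ μ ∨ p.2 ≤ ‖(p.1 : EuclideanSpace ℝ (Fin d)) - x₁‖ := by
    rcases h with h | h
    · exact Eventually.of_forall fun _ => Or.inl h
    · exact (hlim'.eventually_lt hlim (norm_pos_iff.2 (sub_ne_zero.2 h))).mono
        fun p hp => Or.inr hp.le
  have hε : ∀ᶠ ε : ℝ in 𝓝[>] 0, 0 < ε ∧ ε < r / 2 := Ioo_mem_nhdsGT (half_pos hr)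
  filter_upwards [hfar, hε.prod_inr _,
    Eventually.prod_inl (Metric.ball_mem_nhds z (half_pos hr)) _]
  rintro ⟨x, ε⟩ hμ ⟨hε0, hεr⟩ hx
  simp only at hμ hε0 hεr hx ⊢
  rw [Subtype.dist_eq] at hx
  obtain ⟨e, he, hxe⟩ : ∃ e : EuclideanSpace ℝ (Fin d), ‖e‖ = 1 ∧
      (x : EuclideanSpace ℝ (Fin d)) - x₁ = ‖(x : EuclideanSpace ℝ (Fin d)) - x₁‖ • e := by
    rcases eq_or_ne ((x : EuclideanSpace ℝ (Fin d)) - x₁) 0 with h0 | h0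
    · obtain ⟨e, he⟩ := exists_norm_eq (EuclideanSpace ℝ (Fin d)) zero_le_one
      exact ⟨e, he, by simp [h0]⟩
    · have := norm_ne_zero_iff.2 h0
      exact ⟨‖(x : EuclideanSpace ℝ (Fin d)) - x₁‖⁻¹ • (x - x₁), by simp [norm_smul, this],
        by rw [smul_inv_smul₀ this]⟩
  set ξ := ‖(x : EuclideanSpace ℝ (Fin d)) - x₁‖ with hξ
  have hξ0 : 0 ≤ ξ := norm_nonneg _
  -- A radial step, towards the vertex or away from it.
  have hstep (s : ℝ) (hs : |s| = ε) : ∃ y' ∈ intrinsicBall x ε,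
      ‖(y' : EuclideanSpace ℝ (Fin d)) - x₁‖ ^ 2 = (ξ + s) ^ 2 := by
    have hse : ‖s • e‖ = ε := by rw [norm_smul, he, mul_one, Real.norm_eq_abs, hs]
    obtain ⟨y', hy', hmem⟩ := exists_mem_intrinsicBall_of_ball_subset hball (x := x) (w := s • e)
      (by linarith) hse.le
    refine ⟨y', hmem, ?_⟩
    have : (y' : EuclideanSpace ℝ (Fin d)) - x₁ = (ξ + s) • e := by
      rw [hy', add_sub_right_comm, hxe, add_smul]
    rw [this, norm_smul, he, mul_one, Real.norm_eq_abs, sq_abs]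
  have hη' : 0 ≤ ε ^ 2 * η := by positivity
  rcases le_or_gt 0 μ with hμ0 | hμ0
  · obtain ⟨y', hy', h1⟩ := hstep (-ε) (by rw [abs_neg, abs_of_pos hε0])
    refine ⟨y', hy', fun y hy => ?_⟩
    have hyx := dist_le_of_mem_intrinsicBall hε0.le hy
    have h2 : ‖(y : EuclideanSpace ℝ (Fin d)) - x₁‖ ≤ ξ + ε := by
      rw [dist_eq_norm] at hyx
      have := norm_add_le ((y : EuclideanSpace ℝ (Fin d)) - x) (x - x₁)
      rw [sub_add_sub_cancel] at this
      linarith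
    have h3 := mul_le_mul_of_nonneg_left (pow_le_pow_left₀ (norm_nonneg _) h2 2)
      (show 0 ≤ μ / 2 by positivity)
    rw [h1]
    linarith
  · have hμ' := hμ.resolve_left hμ0.not_ge
    obtain ⟨y', hy', h1⟩ := hstep ε (abs_of_pos hε0)
    refine ⟨y', hy', fun y hy => ?_⟩
    have hyx := dist_le_of_mem_intrinsicBall hε0.le hy
    have h2 : ξ - ε ≤ ‖(y : EuclideanSpace ℝ (Fin d)) - x₁‖ := by
      rw [dist_comm, dist_eq_norm] at hyx
      have := norm_add_le ((x : EuclideanSpace ℝ (Fin d)) - y) (y - x₁)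
      rw [sub_add_sub_cancel] at this
      linarith
    have h3 := mul_le_mul_of_nonpos_left (pow_le_pow_left₀ (sub_nonneg.2 hμ') h2 2)
      (show μ / 2 ≤ 0 by linarith)
    rw [h1]
    linarith

end Smooth

end TugOfWar

namespace TugOfWar

/-! ### Limits of solutions of the discrete equation -/

section Limit

variable {d : ℕ} {S : Set (EuclideanSpace ℝ (Fin d))}

/-- If `u - φ` is maximal at `x` over a set containing the ball, the discrete infinity Laplacian of
`u` at `x` is at most that of `φ`. -/
theorem discreteInfLaplacian_le [CompactSpace S] {u : S → ℝ} (hu : Continuous u)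
    {φ : EuclideanSpace ℝ (Fin d) → ℝ} {N : Set S} {x : S} {ε B : ℝ} (hε : 0 < ε)
    (hmax : IsMaxOn (fun y : S => u y - φ y) N x) (hN : intrinsicBall x ε ⊆ N) {y' : S}
    (hy' : y' ∈ intrinsicBall x ε)
    (hB : ∀ y ∈ intrinsicBall x ε, φ y + φ y' - 2 * φ x ≤ ε ^ 2 * B) :
    discreteInfLaplacian ε u x ≤ B := by
  have hbdd : BddBelow (u '' intrinsicBall x ε) :=
    (isCompact_range hu).bddBelow.mono (image_subset_range _ _)
  have hle {y : S} (hy : y ∈ intrinsicBall x ε) : u y - φ y ≤ u x - φ x := hmax (hN hy)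
  have h1 : sInf (u '' intrinsicBall x ε) ≤ u y' := csInf_le hbdd (mem_image_of_mem u hy')
  have h2 : sSup (u '' intrinsicBall x ε) ≤ ε ^ 2 * B + 2 * u x - u y' :=
    sSup_image_le ⟨x, mem_intrinsicBall_self x ε⟩ fun y hy => by
      linarith [hB y hy, hle hy, hle hy']
  rw [discreteInfLaplacian, div_le_iff₀ (by positivity)]
  linarith

/-- Maximum points of uniformly convergent functions accumulate at a maximum point of the limit. -/
theorem exists_tendsto_isMaxOn {X : Type*} [MetricSpace X] {N : Set X} (hN : IsCompact N)
    (hne : N.Nonempty) {w : ℕ → X → ℝ} {v : X → ℝ} (hw : ∀ n, ContinuousOn (w n) N)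
    (hwv : TendstoUniformlyOn w v atTop N) :
    ∃ x ∈ N, IsMaxOn v N x ∧ ∃ ψ : ℕ → ℕ, StrictMono ψ ∧ ∃ y : ℕ → X, (∀ n, y n ∈ N) ∧
      (∀ n, IsMaxOn (w (ψ n)) N (y n)) ∧ Tendsto y atTop (𝓝 x) := by
  choose y hyN hy using fun n => hN.exists_isMaxOn hne (hw n)
  obtain ⟨x, hx, ψ, hψ, hlim⟩ := hN.tendsto_subseq hyN
  refine ⟨x, hx, fun z hz => ?_, ψ, hψ, y ∘ ψ, fun n => hyN _, fun n => hy _, hlim⟩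
  have hv : ContinuousOn v N := hwv.continuousOn (Frequently.of_forall hw)
  have hlimN : Tendsto (y ∘ ψ) atTop (𝓝[N] x) :=
    tendsto_nhdsWithin_iff.2 ⟨hlim, Eventually.of_forall fun n => hyN _⟩
  have hwvψ : TendstoUniformlyOn (fun n => w (ψ n)) v atTop N := fun U hU =>
    hψ.tendsto_atTop.eventually (hwv U hU)
  have h1 : Tendsto (fun n => w (ψ n) (y (ψ n))) atTop (𝓝 (v x)) :=
    hwvψ.tendsto_comp (hv x hx) hlimN
  exact le_of_tendsto_of_tendsto' (hwvψ.tendsto_at hz) h1 fun n => hy (ψ n) hz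

/-- Passage to the limit in the discrete equation at a maximum point of `v - φ`. -/
theorem exists_isMaxOn_neg_le [CompactSpace S] {f : S → ℝ} (hf : Continuous f) {c : ℕ → ℝ}
    {c' : ℝ} (hc : Tendsto c atTop (𝓝 c')) {ε : ℕ → ℝ} (hε : ∀ n, 0 < ε n)
    (hε0 : Tendsto ε atTop (𝓝 0)) {u : ℕ → S → ℝ} (hu : ∀ n, Continuous (u n))
    (heq : ∀ n x, -discreteInfLaplacian (ε n) (u n) x = f x - c n) {v : S → ℝ}
    (hv : TendstoUniformly u v atTop) {φ : EuclideanSpace ℝ (Fin d) → ℝ} {N : Set S}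
    (hN : IsCompact N) (hne : N.Nonempty) (hφ : ContinuousOn (fun x : S => φ x) N) {Λ : ℝ}
    (hmax : ∀ x ∈ N, IsMaxOn (fun y : S => v y - φ y) N x → N ∈ 𝓝 x ∧ HasDiscreteBound φ x Λ) :
    ∃ x ∈ N, IsMaxOn (fun y : S => v y - φ y) N x ∧ -Λ ≤ f x - c' := by
  have hunif : TendstoUniformlyOn (fun n (y : S) => u n y - φ y) (fun y : S => v y - φ y)
      atTop N := by
    rw [Metric.tendstoUniformlyOn_iff]
    intro η hη
    filter_upwards [Metric.tendstoUniformly_iff.1 hv η hη] with n hn x _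
    rw [dist_sub_right]
    exact hn x
  obtain ⟨x, hx, hxmax, ψ, hψ, y, -, hymax, hlim⟩ := exists_tendsto_isMaxOn hN hne
    (fun n => (hu n).continuousOn.sub hφ) hunif
  obtain ⟨hNx, hB⟩ := hmax x hx hxmax
  refine ⟨x, hx, hxmax, ?_⟩
  have hεψ : Tendsto (fun n => ε (ψ n)) atTop (𝓝[>] 0) :=
    tendsto_nhdsWithin_iff.2 ⟨hε0.comp hψ.tendsto_atTop, Eventually.of_forall fun n => hε _⟩
  have hpair : Tendsto (fun n => (y n, ε (ψ n))) atTop (𝓝 x ×ˢ 𝓝[>] 0) := hlim.prodMk hεψ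
  have hball : ∀ᶠ n in atTop, intrinsicBall (y n) (ε (ψ n)) ⊆ N := by
    obtain ⟨r, hr, hball⟩ := Metric.mem_nhds_iff.1 hNx
    filter_upwards [hlim.eventually (Metric.ball_mem_nhds x (half_pos hr)),
      (hε0.comp hψ.tendsto_atTop).eventually (gt_mem_nhds (half_pos hr))] with n h1 h2 z hz
    apply hball
    have h3 := dist_le_of_mem_intrinsicBall (hε _).le hz
    rw [Metric.mem_ball]
    have h1' : dist (y n) x < r / 2 := h1
    rw [← Subtype.dist_eq] at h3
    have h4 : ε (ψ n) < r / 2 := h2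
    linarith [dist_triangle z (y n) x]
  refine le_of_forall_pos_le_add fun η hη => ?_
  have hev : ∀ᶠ n in atTop, -(f (y n) - c (ψ n)) ≤ Λ + η := by
    filter_upwards [hpair.eventually (hB η hη), hball] with n ⟨y', hy', h⟩ hn
    rw [← heq, neg_neg]
    exact discreteInfLaplacian_le (hu _) (hε _) (hymax n) hn hy' h
  have hlim' : Tendsto (fun n => -(f (y n) - c (ψ n))) atTop (𝓝 (-(f x - c'))) :=
    (((hf.tendsto x).comp hlim).sub (hc.comp hψ.tendsto_atTop)).neg
  linarith [le_of_tendsto hlim' hev]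

end Limit

/-! ### The limit is a viscosity solution -/

section Viscosity

variable {d : ℕ} {Ω : Set (EuclideanSpace ℝ (Fin d))}

/-- The viscosity inequality where the gradient of the test function does not vanish. -/
theorem neg_infLaplacianPlus_le_of_gradient_ne_zero [CompactSpace (closure Ω)] {f : closure Ω → ℝ}
    (hf : Continuous f) {c : ℕ → ℝ} {c' : ℝ} (hc : Tendsto c atTop (𝓝 c')) {ε : ℕ → ℝ}
    (hε : ∀ n, 0 < ε n) (hε0 : Tendsto ε atTop (𝓝 0)) {u : ℕ → closure Ω → ℝ}
    (hu : ∀ n, Continuous (u n))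
    (heq : ∀ n x, -discreteInfLaplacian (ε n) (u n) x = f x - c n) {v : closure Ω → ℝ}
    (hv : TendstoUniformly u v atTop) {φ : EuclideanSpace ℝ (Fin d) → ℝ} {x₀ : closure Ω}
    (hφ : ContDiffAt ℝ 2 φ x₀) (hmax : ∀ᶠ x in 𝓝[≠] x₀, v x - φ x < v x₀ - φ x₀)
    (hgrad : gradient φ x₀ ≠ 0)
    (hin : IsInwardAt (closure Ω) x₀ (-(‖gradient φ x₀‖⁻¹ • gradient φ x₀))) :
    -infLaplacianPlus φ x₀ ≤ f x₀ - c' := by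
  have hcont : ∀ᶠ x : closure Ω in 𝓝 x₀, ContinuousAt φ x :=
    continuous_subtype_val.continuousAt.eventually
      ((hφ.eventually (by simp)).mono fun x hx => hx.continuousAt)
  obtain ⟨r, hr, hN⟩ := Metric.nhds_basis_closedBall.eventually_iff.1
    ((eventually_nhdsWithin_iff.1 hmax).and hcont)
  have huniq : ∀ x ∈ Metric.closedBall x₀ r,
      IsMaxOn (fun y : closure Ω => v y - φ y) (Metric.closedBall x₀ r) x → x = x₀ := by
    intro x hx hxmax
    by_contra hne
    exact ((hN hx).1 hne).not_ge (hxmax (Metric.mem_closedBall_self hr.le))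
  obtain ⟨x, hx, hxmax, h⟩ := exists_isMaxOn_neg_le hf hc hε hε0 hu heq hv
    (Metric.isClosed_closedBall (x := x₀) (ε := r)).isCompact
    ⟨x₀, Metric.mem_closedBall_self hr.le⟩ (φ := φ) (Λ := infLaplacianPlus φ x₀)
    (fun x hx => ((hN hx).2.comp continuous_subtype_val.continuousAt).continuousWithinAt)
    (fun x hx hxmax => by
      rw [huniq x hx hxmax]
      exact ⟨Metric.closedBall_mem_nhds x₀ hr,
        hasDiscreteBound_of_gradient_ne_zero hφ hgrad hin⟩)
  rwa [huniq x hx hxmax] at h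

/-- The viscosity inequality at interior critical points of the test function. The test function
is replaced by a parabola whose vertex is moved slightly away from `x₀`, so that the maximum point
differs from the vertex if the parabola is concave. -/
theorem neg_infLaplacianPlus_le_of_gradient_eq_zero [CompactSpace (closure Ω)]
    [Nontrivial (EuclideanSpace ℝ (Fin d))] (hΩ : IsOpen Ω) {f : closure Ω → ℝ}
    (hf : Continuous f) {c : ℕ → ℝ} {c' : ℝ} (hc : Tendsto c atTop (𝓝 c')) {ε : ℕ → ℝ}
    (hε : ∀ n, 0 < ε n) (hε0 : Tendsto ε atTop (𝓝 0)) {u : ℕ → closure Ω → ℝ}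
    (hu : ∀ n, Continuous (u n))
    (heq : ∀ n x, -discreteInfLaplacian (ε n) (u n) x = f x - c n) {v : closure Ω → ℝ}
    (hv : TendstoUniformly u v atTop) {φ : EuclideanSpace ℝ (Fin d) → ℝ} {x₀ : closure Ω}
    (hx₀ : (x₀ : EuclideanSpace ℝ (Fin d)) ∈ Ω)
    (hφ : ContDiffAt ℝ 2 φ x₀) (hmax : ∀ᶠ x in 𝓝[≠] x₀, v x - φ x < v x₀ - φ x₀)
    (hgrad : gradient φ x₀ = 0) :
    -infLaplacianPlus φ x₀ ≤ f x₀ - c' := by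
  by_contra! hlt
  set l := infLaplacianPlus φ x₀ with hl
  obtain ⟨θ, hθ, hlθ⟩ : ∃ θ > 0, f x₀ - c' < -(l + 4 * θ) :=
    ⟨(-l - (f x₀ - c')) / 8, by linarith, by linarith⟩
  set μ := l + 4 * θ with hμ
  obtain ⟨r₁, hr₁, hT⟩ := exists_abs_taylor_le hφ hθ
  have hval : Tendsto (fun x : closure Ω => (x : EuclideanSpace ℝ (Fin d))) (𝓝 x₀)
      (𝓝 (x₀ : EuclideanSpace ℝ (Fin d))) := continuous_subtype_val.continuousAt
  obtain ⟨r, hr, hN⟩ := Metric.nhds_basis_closedBall.eventually_iff.1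
    ((eventually_nhdsWithin_iff.1 hmax).and ((hval.eventually (hΩ.mem_nhds hx₀)).and
      ((hval.eventually (Metric.ball_mem_nhds _ hr₁)).and
        ((hf.sub continuous_const).continuousAt.eventually_lt_const hlθ))))
  -- Strict comparison with a parabola with vertex `x₀`.
  have hpar : ∀ x ∈ Metric.closedBall x₀ r,
      v x - v x₀ ≤ (μ / 2 - θ) * ‖(x : EuclideanSpace ℝ (Fin d)) - x₀‖ ^ 2 := by
    intro x hx
    obtain ⟨h1, -, h3, -⟩ := hN hx
    have h4 : v x - φ x ≤ v x₀ - φ x₀ := by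
      rcases eq_or_ne x x₀ with rfl | hne
      · exact le_rfl
      · exact (h1 hne).le
    have h5 := hT x₀ (by simpa using hr₁) (x - x₀) (by rw [← dist_eq_norm]; exact h3)
    have h6 : fderiv ℝ φ x₀ = 0 := by
      rw [← toDual_gradient, hgrad, map_zero]
    rw [add_sub_cancel, h6, zero_apply] at h5
    have h7 := hessianForm_le_infLaplacianPlus hgrad ((x : EuclideanSpace ℝ (Fin d)) - x₀)
    rw [← hl] at h7
    have h8 := (abs_le.1 h5).2
    rw [hμ]
    linarith
  obtain ⟨x₁, hx₁ne, hx₁, hx₁Ω⟩ : ∃ x₁ : EuclideanSpace ℝ (Fin d), x₁ ≠ x₀ ∧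
      dist x₁ x₀ < min r (θ * r / (|μ| + 1)) ∧ x₁ ∈ Ω := by
    have h1 : ∀ᶠ x₁ : EuclideanSpace ℝ (Fin d) in 𝓝[≠] (x₀ : EuclideanSpace ℝ (Fin d)), x₁ ≠ x₀ ∧
        dist x₁ x₀ < min r (θ * r / (|μ| + 1)) ∧ x₁ ∈ Ω := by
      filter_upwards [self_mem_nhdsWithin, nhdsWithin_le_nhds (Metric.ball_mem_nhds _
        (show 0 < min r (θ * r / (|μ| + 1)) by positivity)),
        nhdsWithin_le_nhds (hΩ.mem_nhds hx₀)] with x h1 h2 h3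
      exact ⟨h1, h2, h3⟩
    exact h1.exists
  rw [lt_min_iff, lt_div_iff₀ (by positivity)] at hx₁
  set b := ‖x₁ - x₀‖ with hb
  have hb0 : 0 < b := norm_pos_iff.2 (sub_ne_zero.2 hx₁ne)
  rw [dist_eq_norm, ← hb] at hx₁
  obtain ⟨x, hx, -, h⟩ := exists_isMaxOn_neg_le hf hc hε hε0 hu heq hv
    (Metric.isClosed_closedBall (x := x₀) (ε := r)).isCompact
    ⟨x₀, Metric.mem_closedBall_self hr.le⟩ (φ := fun x => μ / 2 * ‖x - x₁‖ ^ 2) (Λ := μ)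
    (by fun_prop) (fun x hx hxmax => by
      have h1 : v x₀ - μ / 2 * ‖(x₀ : EuclideanSpace ℝ (Fin d)) - x₁‖ ^ 2
          ≤ v x - μ / 2 * ‖(x : EuclideanSpace ℝ (Fin d)) - x₁‖ ^ 2 :=
        hxmax (Metric.mem_closedBall_self hr.le)
      rw [norm_sub_rev, ← hb] at h1
      have h2 := hpar x hx
      refine ⟨?_, ?_⟩
      · have h3 : ‖(x : EuclideanSpace ℝ (Fin d)) - x₁‖ ^ 2
            = ‖(x : EuclideanSpace ℝ (Fin d)) - x₀‖ ^ 2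
              - 2 * inner ℝ ((x : EuclideanSpace ℝ (Fin d)) - x₀) (x₁ - x₀) + b ^ 2 := by
          rw [hb, ← norm_sub_sq_real, sub_sub_sub_cancel_right]
        have h4 := abs_real_inner_le_norm ((x : EuclideanSpace ℝ (Fin d)) - x₀) (x₁ - x₀)
        rw [← hb] at h4
        set a := ‖(x : EuclideanSpace ℝ (Fin d)) - x₀‖ with ha
        have ha0 : 0 ≤ a := norm_nonneg _
        set i := inner ℝ ((x : EuclideanSpace ℝ (Fin d)) - x₀) (x₁ - x₀) with hi
        have h5 : μ * i ≤ |μ| * (a * b) := by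
          refine (le_abs_self _).trans ?_
          rw [abs_mul]
          gcongr
        rw [h3] at h1
        have h6 : θ * a ^ 2 ≤ |μ| * (a * b) := by linarith
        have h7 : a < r := by
          by_contra! hra
          have h8 : θ * a ≤ |μ| * b := by
            refine le_of_mul_le_mul_left (a := a) ?_ (hr.trans_le hra)
            linarith
          have h9 : θ * r ≤ θ * a := by gcongr
          linarith [hx₁.2]
        refine mem_of_superset (Metric.isOpen_ball.mem_nhds ?_) Metric.ball_subset_closedBall
        rw [Metric.mem_ball, Subtype.dist_eq, dist_eq_norm]
        exact h7
      · refine hasDiscreteBound_quadratic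
          (mem_of_superset (hΩ.mem_nhds (hN hx).2.1) subset_closure) ?_
        by_contra! hneg
        rw [hneg.2, sub_self, norm_zero] at h1
        rw [hneg.2, ← hb] at h2
        have h3 : μ * b ^ 2 < 0 := mul_neg_of_neg_of_pos hneg.1 (by positivity)
        have h4 : 0 < θ * b ^ 2 := by positivity
        linarith)
  have h1 : f x - c' < -μ := (hN hx).2.2.2
  linarith

theorem isViscositySubsolution_of_tendstoUniformly (hd : 1 ≤ d) (hΩ : IsOpen Ω)
    (hbdd : Bornology.IsBounded Ω) (hbdry : HasC1Boundary Ω) {f : closure Ω → ℝ}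
    (hf : Continuous f) {c : ℕ → ℝ} {c' : ℝ} (hc : Tendsto c atTop (𝓝 c')) {ε : ℕ → ℝ}
    (hε : ∀ n, 0 < ε n) (hε0 : Tendsto ε atTop (𝓝 0)) {u : ℕ → closure Ω → ℝ}
    (hu : ∀ n, Continuous (u n))
    (heq : ∀ n x, -discreteInfLaplacian (ε n) (u n) x = f x - c n) {v : closure Ω → ℝ}
    (hv : TendstoUniformly u v atTop) : IsViscositySubsolution Ω (fun x => f x - c') v := by
  have : CompactSpace (closure Ω) := isCompact_iff_compactSpace.1 hbdd.isCompact_closure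
  have : Nonempty (Fin d) := ⟨⟨0, hd⟩⟩
  refine ⟨hv.continuous (Frequently.of_forall hu), ?_⟩
  rintro φ ⟨W, hW, hΩW, hφ⟩ x₀ hmax
  have hφ' : ContDiffAt ℝ 2 φ x₀ :=
    (hφ.contDiffAt (hW.mem_nhds (hΩW x₀.2))).of_le (by norm_cast)
  by_cases hbd : (x₀ : EuclideanSpace ℝ (Fin d)) ∈ frontier Ω ∧
      inner ℝ (gradient φ x₀) (outwardNormal Ω x₀) ≤ 0
  · exact Or.inr hbd
  refine Or.inl ?_
  have hΩ_or : (x₀ : EuclideanSpace ℝ (Fin d)) ∈ Ω ∨ (x₀ : EuclideanSpace ℝ (Fin d)) ∈ frontier Ω :=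
    by
      rw [hΩ.frontier_eq]
      by_cases h : (x₀ : EuclideanSpace ℝ (Fin d)) ∈ Ω
      · exact Or.inl h
      · exact Or.inr ⟨x₀.2, h⟩
  by_cases hgrad : gradient φ x₀ = 0
  · refine neg_infLaplacianPlus_le_of_gradient_eq_zero hΩ hf hc hε hε0 hu heq hv ?_ hφ' hmax hgrad
    refine hΩ_or.resolve_right fun h => hbd ⟨h, ?_⟩
    rw [hgrad, inner_zero_left]
  · refine neg_infLaplacianPlus_le_of_gradient_ne_zero hf hc hε hε0 hu heq hv hφ' hmax hgrad ?_
    rcases hΩ_or with h | h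
    · exact isInwardAt_of_mem hΩ h _
    · refine isInwardAt_of_inner_outwardNormal_neg hΩ hbdry h ?_
      rw [inner_neg_left, real_inner_smul_left, neg_lt_zero]
      exact mul_pos (inv_pos.2 (norm_pos_iff.2 hgrad)) (not_le.1 fun h' => hbd ⟨h, h'⟩)

theorem discreteInfLaplacian_neg {S : Set (EuclideanSpace ℝ (Fin d))} (ε : ℝ) (u : S → ℝ) (x : S) :
    discreteInfLaplacian ε (fun y => -u y) x = -discreteInfLaplacian ε u x := by
  rw [discreteInfLaplacian, discreteInfLaplacian, sInf_image_neg, sSup_image_neg]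
  ring

theorem isViscositySolution_of_tendstoUniformly (hd : 1 ≤ d) (hΩ : IsOpen Ω)
    (hbdd : Bornology.IsBounded Ω) (hbdry : HasC1Boundary Ω) {f : closure Ω → ℝ}
    (hf : Continuous f) {c : ℕ → ℝ} {c' : ℝ} (hc : Tendsto c atTop (𝓝 c')) {ε : ℕ → ℝ}
    (hε : ∀ n, 0 < ε n) (hε0 : Tendsto ε atTop (𝓝 0)) {u : ℕ → closure Ω → ℝ}
    (hu : ∀ n, Continuous (u n))
    (heq : ∀ n x, -discreteInfLaplacian (ε n) (u n) x = f x - c n) {v : closure Ω → ℝ}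
    (hv : TendstoUniformly u v atTop) : IsViscositySolution Ω (fun x => f x - c') v := by
  refine ⟨isViscositySubsolution_of_tendstoUniformly hd hΩ hbdd hbdry hf hc hε hε0 hu heq hv, ?_⟩
  have hv' : TendstoUniformly (fun n x => -u n x) (fun x => -v x) atTop := by
    rw [Metric.tendstoUniformly_iff] at hv ⊢
    simpa only [dist_neg_neg] using hv
  have h := isViscositySubsolution_of_tendstoUniformly hd hΩ hbdd hbdry hf.neg hc.neg hε hε0
    (fun n => (hu n).neg) (fun n x => by
      have := discreteInfLaplacian_neg (ε n) (u n) x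
      have := heq n x
      simp only [Pi.neg_def, Pi.neg_apply] at *
      linarith) hv'
  unfold IsViscositySupersolution
  convert h using 2
  simp only [Pi.neg_apply]
  ring

end Viscosity

end TugOfWar

theorem mainTheorem6 (d : ℕ) (hd : 1 ≤ d) (Ω : Set (EuclideanSpace ℝ (Fin d)))
    (hΩ_open : IsOpen Ω) (hΩ_conn : IsConnected Ω) (hΩ_bdd : Bornology.IsBounded Ω)
    (hΩ_bdry : TugOfWar.HasC1Boundary Ω)
    (f : closure Ω → ℝ) (hf : Continuous f)
    (ε : ℕ → ℝ) (hε_pos : ∀ n, 0 < ε n) (hε_lim : Tendsto ε atTop (𝓝 0))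
    (u : ℕ → closure Ω → ℝ) (hu_cont : ∀ n, Continuous (u n))
    (hu_eq : ∀ n x, -TugOfWar.discreteInfLaplacian (ε n) (u n) x
      = f x - TugOfWar.shiftConst f (ε n))
    (σ : ℕ → ℕ) (hσ : StrictMono σ) (v : closure Ω → ℝ)
    (hv : TendstoUniformly (fun k => u (σ k)) v atTop) :
    (∀ δ : ℝ, 0 < δ →
        TugOfWar.IsLongTermAdvantage (TugOfWar.epsAdj (closure Ω) δ) f
          (TugOfWar.shiftConst f δ)) ∧
      Tendsto (TugOfWar.shiftConst f) (𝓝[>] (0 : ℝ)) (𝓝 (TugOfWar.limitShiftConst f)) ∧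
      TugOfWar.IsViscositySolution Ω (fun x => f x - TugOfWar.limitShiftConst f) v := by
  have : CompactSpace (closure Ω) := isCompact_iff_compactSpace.1 hΩ_bdd.isCompact_closure
  have : ConnectedSpace (closure Ω) := isConnected_iff_connectedSpace.1 hΩ_conn.closure
  obtain ⟨hfin, R, hρ⟩ := TugOfWar.exists_isBoundedGeodesic_intrinsicEDist (S := closure Ω)
    fun z η hη => by
      obtain ⟨w₀, hw₀⟩ := TugOfWar.exists_isInwardAt hΩ_open hΩ_bdry z.2
      exact hw₀.eventually_intrinsicEDist_le hη
  have hadj (δ : ℝ) (hδ : 0 < δ) : TugOfWar.epsAdj (closure Ω) δ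
      = fun x y => (TugOfWar.intrinsicEDist x y).toReal ≤ δ := by
    ext x y
    exact ENNReal.le_ofReal_iff_toReal_le (hfin x y) hδ.le
  have hfb : ∃ K, ∀ x, |f x| ≤ K := by
    obtain ⟨K, hK⟩ := (isCompact_range hf).isBounded.exists_norm_le
    exact ⟨K, fun x => hK _ (mem_range_self x)⟩
  have hadv (δ : ℝ) (hδ : 0 < δ) : TugOfWar.IsLongTermAdvantage
      (TugOfWar.epsAdj (closure Ω) δ) f (TugOfWar.shiftConst f δ) := by
    apply Classical.epsilon_spec
    rw [hadj δ hδ]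
    exact hρ.exists_isLongTermAdvantage hδ hfb
  have hfu : ∀ η > 0, ∃ δ > 0, ∀ x y : closure Ω,
      (TugOfWar.intrinsicEDist x y).toReal ≤ δ → |f y - f x| ≤ η := by
    intro η hη
    obtain ⟨δ, hδ, h⟩ := Metric.uniformContinuous_iff.1
      (CompactSpace.uniformContinuous_of_continuous hf) η hη
    refine ⟨δ / 2, half_pos hδ, fun x y hxy => (h (lt_of_le_of_lt ?_ (half_lt_self hδ))).le⟩
    exact TugOfWar.dist_le_of_mem_intrinsicBall (half_pos hδ).le
      ((ENNReal.le_ofReal_iff_toReal_le (hfin x y) (half_pos hδ).le).2 hxy)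
  have hlim : Tendsto (TugOfWar.shiftConst f) (𝓝[>] (0 : ℝ))
      (𝓝 (TugOfWar.limitShiftConst f)) :=
    tendsto_nhds_limUnder (hρ.exists_tendsto_longTermAdvantage hfb hfu
      fun δ hδ => hadj δ hδ ▸ hadv δ hδ)
  refine ⟨hadv, hlim, ?_⟩
  have hεσ : Tendsto (fun k => ε (σ k)) atTop (𝓝 0) := hε_lim.comp hσ.tendsto_atTop
  exact TugOfWar.isViscositySolution_of_tendstoUniformly hd hΩ_open hΩ_bdd hΩ_bdry hf
    (hlim.comp (tendsto_nhdsWithin_iff.2 ⟨hεσ, Eventually.of_forall fun k => hε_pos _⟩))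
    (fun k => hε_pos _) hεσ (fun k => hu_cont _) (fun k => hu_eq _) hv
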